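/- Let $K$ be a field of characteristic $0$. **Symmetric functions.** Let $\Lambda$ be the Hopf algebra of symmetric functions over $K$: the power series of bounded degree in $x_1,x_2,\dots$ invariant under all permutations of the variables, with the usual product, graded by degree, in which each power sum $p_n=\sum_{i\ge 1}x_i^n$ ($n\ge 1$) is primitive, i.e. $\Delta p_n=p_n\otimes 1+1\otimes p_n$ and $\varepsilon(p_n)=0$. For a partition $\lambda$ let $\widetilde m_\lambda=\big(\prod_{i\ge1}r_i(\lambda)!\big)\,m_\lambda$, where $m_\lambda$ is the monomial symmetric function (the sum of all distinct monomials whose nonzero exponents are the parts of $\lambda$) and $r_i(\lambda)$ is the number of parts of $\lambda$ equal to $i$; write $\widetilde m_n$ for the case of a single part $n$. Let $\widetilde\Lambda$ be the graded Hopf algebra with the same underlying vector space, grading, coproduct and counit as $\Lambda$, but with the product $\odot$ given by $\widetilde m_\lambda\odot\widetilde m_\mu=\widetilde m_{\lambda\sqcup\mu}$, where $\lambda\sqcup\mu$ is the partition formed by all parts of $\lambda$ together with all parts of $\mu$. **Chromatic symmetric functions.** For a finite simple graph $G$ (unweighted, i.e. all vertices have weight $1$) let $X_G=\sum_\kappa\prod_{v\in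 V(G)}x_{\kappa(v)}$, the sum over all proper colorings $\kappa:V(G)\to\{1,2,\dots\}$, and let $\overline G$ be the complement of $G$. **Proposition.** There is one and only one morphism of graded Hopf algebras $\varphi:\Lambda\to\widetilde\Lambda$ such that $\varphi(X_G)=X_{\overline G}$ for every finite unweighted triangle-free graph $G$ simultaneously. Explicitly, it is the algebra morphism with $\varphi(p_1)=\widetilde m_1$, $\varphi(p_2)=-\widetilde m_2$, and $\varphi(p_n)=0$ for all $n\ge 3$. -/

import Mathlib

universe u v

noncomputable section

open scoped TensorProduct

namespace SymmFun

/-- The algebra `Λ` of symmetric functions over `K` in the variables `x 0, x 1, x 2, …`: power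
series that are invariant under every permutation of the variables and have bounded degree. -/
def Lambda (K : Type*) [Field K] : Subalgebra K (MvPowerSeries ℕ K) where
  carrier := {f | (∀ σ : Equiv.Perm ℕ, MvPowerSeries.rename σ f = f) ∧
    ∃ N : ℕ, ∀ d : ℕ →₀ ℕ, MvPowerSeries.coeff d f ≠ 0 → d.degree ≤ N}
  mul_mem' := by
    rintro f g ⟨hf, N, hN⟩ ⟨hg, M, hM⟩
    refine ⟨fun σ => by rw [map_mul, hf, hg], N + M, fun d hd => ?_⟩
    rw [MvPowerSeries.coeff_mul] at hd
    obtain ⟨⟨a, b⟩, hab, hne⟩ := Finset.exists_ne_zero_of_sum_ne_zero hd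
    rw [← Finset.HasAntidiagonal.mem_antidiagonal.1 hab, map_add]
    exact add_le_add (hN a (left_ne_zero_of_mul hne)) (hM b (right_ne_zero_of_mul hne))
  add_mem' := by
    rintro f g ⟨hf, N, hN⟩ ⟨hg, M, hM⟩
    refine ⟨fun σ => by rw [map_add, hf, hg], max N M, fun d hd => ?_⟩
    rw [map_add] at hd
    by_cases h : MvPowerSeries.coeff d f = 0
    · rw [h, zero_add] at hd
      exact le_max_of_le_right (hM d hd)
    · exact le_max_of_le_left (hN d h)
  algebraMap_mem' := by
    intro r
    refine ⟨fun σ => AlgHom.commutes _ r, 0, fun d hd => ?_⟩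
    rw [MvPowerSeries.algebraMap_apply, Algebra.algebraMap_self_apply,
      MvPowerSeries.coeff_C] at hd
    by_cases h : d = 0
    · simp [h]
    · simp [h] at hd

variable {K : Type*} [Field K]

theorem coeff_rename_perm (σ : Equiv.Perm ℕ) (f : MvPowerSeries ℕ K) (d : ℕ →₀ ℕ) :
    MvPowerSeries.coeff (d.mapDomain σ) (MvPowerSeries.rename σ f) = MvPowerSeries.coeff d f := by
  have := MvPowerSeries.coeff_embDomain_rename σ.toEmbedding f d
  rwa [Finsupp.embDomain_eq_mapDomain] at this

theorem coeff_mapDomain {f : MvPowerSeries ℕ K} (hf : f ∈ Lambda K) (σ : Equiv.Perm ℕ)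
    (d : ℕ →₀ ℕ) : MvPowerSeries.coeff (d.mapDomain σ) f = MvPowerSeries.coeff d f := by
  conv_lhs => rw [← hf.1 σ]
  exact coeff_rename_perm σ f d

theorem mem_Lambda_of {f : MvPowerSeries ℕ K} (N : ℕ)
    (h : ∀ d : ℕ →₀ ℕ, MvPowerSeries.coeff d f ≠ 0 → d.degree ≤ N)
    (hf : ∀ (σ : Equiv.Perm ℕ) (d : ℕ →₀ ℕ),
      MvPowerSeries.coeff (d.mapDomain σ) f = MvPowerSeries.coeff d f) : f ∈ Lambda K := by
  refine ⟨fun σ => ?_, N, h⟩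
  ext d
  have : d = (d.mapDomain σ.symm).mapDomain σ := by
    rw [← Finsupp.mapDomain_comp]; simp
  rw [this, coeff_rename_perm, hf σ]

/-! ### Partitions and the augmented monomial symmetric functions

A partition is encoded by its multiplicities `r : ℕ+ →₀ ℕ`: the part `k` occurs `r k` times. -/

/-- The partition formed by the nonzero exponents of the monomial `x ^ d`. -/
def expType (d : ℕ →₀ ℕ) : ℕ+ →₀ ℕ :=
  d.sum fun _ a => Finsupp.single a.toPNat' 1

theorem expType_apply (d : ℕ →₀ ℕ) (k : ℕ+) :
    expType d k = (d.support.filter fun i => d i = k).card := by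
  rw [expType, Finsupp.sum, Finsupp.finsetSum_apply, Finset.card_filter]
  refine Finset.sum_congr rfl fun i hi => ?_
  have h0 : 0 < d i := Nat.pos_of_ne_zero (Finsupp.mem_support_iff.1 hi)
  rw [Finsupp.single_apply]
  refine if_congr ?_ rfl rfl
  rw [← PNat.coe_inj, Nat.toPNat'_coe, if_pos h0]

/-- The size of a partition, i.e. the sum of its parts. -/
def size (r : ℕ+ →₀ ℕ) : ℕ := r.sum fun k m => m * (k : ℕ)

theorem size_expType (d : ℕ →₀ ℕ) : size (expType d) = d.degree := by
  rw [size, expType, Finsupp.sum.eq_1 d, ← Finsupp.sum_finsetSum_index (by simp) (by intros; ring),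
    Finsupp.degree_apply]
  refine Finset.sum_congr rfl fun i hi => ?_
  have h0 : 0 < d i := Nat.pos_of_ne_zero (Finsupp.mem_support_iff.1 hi)
  simp [h0]

theorem expType_mapDomain (σ : Equiv.Perm ℕ) (d : ℕ →₀ ℕ) :
    expType (d.mapDomain σ) = expType d :=
  Finsupp.sum_mapDomain_index_inj σ.injective

theorem degree_mapDomain (σ : Equiv.Perm ℕ) (d : ℕ →₀ ℕ) :
    (d.mapDomain σ).degree = d.degree := by
  rw [← size_expType, expType_mapDomain, size_expType]

/-- The product of the factorials `(r k)!`. -/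
def factProd (r : ℕ+ →₀ ℕ) : ℕ := r.prod fun _ m => m.factorial

theorem factProd_ne_zero (r : ℕ+ →₀ ℕ) : factProd r ≠ 0 :=
  Finset.prod_ne_zero_iff.2 fun _ _ => Nat.factorial_ne_zero _

/-- The monomial symmetric function `m_r`: the sum of all distinct monomials whose
nonzero exponents are the parts of `r`. -/
def msymm (K : Type*) [Field K] (r : ℕ+ →₀ ℕ) : Lambda K :=
  ⟨fun d => if expType d = r then 1 else 0, by
    refine mem_Lambda_of (size r) (fun d hd => ?_) (fun σ d => ?_)
    · have hd' : (if expType d = r then (1 : K) else 0) ≠ 0 := hd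
      have : expType d = r := by
        by_contra h
        simp [h] at hd'
      rw [← this, size_expType]
    · change (if expType (d.mapDomain σ) = r then (1 : K) else 0) = if expType d = r then 1 else 0
      rw [expType_mapDomain]⟩

/-- The augmented monomial symmetric function `m̃_r = (∏ k, (r k)!) • m_r`. -/
def mtilde (K : Type*) [Field K] (r : ℕ+ →₀ ℕ) : Lambda K :=
  (factProd r : K) • msymm K r

theorem coeff_mtilde (r : ℕ+ →₀ ℕ) (d : ℕ →₀ ℕ) :
    MvPowerSeries.coeff d (mtilde K r : MvPowerSeries ℕ K) =
      if expType d = r then (factProd r : K) else 0 := by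
  change (factProd r : K) * (if expType d = r then (1 : K) else 0) = _
  simp

open Classical in
/-- The power sum `p_n = x 0 ^ n + x 1 ^ n + x 2 ^ n + ⋯`. -/
def psum (K : Type*) [Field K] (n : ℕ+) : Lambda K :=
  ⟨fun d => if ∃ i : ℕ, d = Finsupp.single i (n : ℕ) then 1 else 0, by
    refine mem_Lambda_of n (fun d hd => ?_) (fun σ d => ?_)
    · have hd' : (if ∃ i : ℕ, d = Finsupp.single i (n : ℕ) then (1 : K) else 0) ≠ 0 := hd
      have : ∃ i : ℕ, d = Finsupp.single i (n : ℕ) := by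
        by_contra h
        simp [h] at hd'
      obtain ⟨i, rfl⟩ := this
      simp
    · change (if ∃ i : ℕ, d.mapDomain σ = Finsupp.single i (n : ℕ) then (1 : K) else 0) =
        if ∃ i : ℕ, d = Finsupp.single i (n : ℕ) then (1 : K) else 0
      refine if_congr ⟨?_, ?_⟩ rfl rfl
      · rintro ⟨i, hi⟩
        refine ⟨σ.symm i, Finsupp.mapDomain_injective σ.injective ?_⟩
        rw [hi, Finsupp.mapDomain_single, Equiv.apply_symm_apply]
      · rintro ⟨i, rfl⟩
        exact ⟨σ i, Finsupp.mapDomain_single⟩⟩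

/-! ### Chromatic symmetric functions -/

/-- The chromatic symmetric function `X_G` of a finite graph `G` with vertex weights `w`: the
coefficient of the monomial `x ^ d` is the number of proper colourings `κ` of `G` by the colours
`0, 1, 2, …` such that `∏ v, x (κ v) ^ w v = x ^ d`. -/
def csf (K : Type*) [Field K] {V : Type*} [Fintype V] (G : SimpleGraph V) (w : V → ℕ+) :
    Lambda K :=
  ⟨fun d => (Nat.card {κ : G.Coloring ℕ // ∑ v, Finsupp.single (κ v) (w v : ℕ) = d} : K), by
    refine mem_Lambda_of (∑ v, (w v : ℕ)) (fun d hd => ?_) (fun σ d => ?_)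
    · have hd' : (Nat.card {κ : G.Coloring ℕ //
          ∑ v, Finsupp.single (κ v) (w v : ℕ) = d} : K) ≠ 0 := hd
      have hne : Nonempty {κ : G.Coloring ℕ // ∑ v, Finsupp.single (κ v) (w v : ℕ) = d} := by
        by_contra h
        rw [not_nonempty_iff] at h
        simp at hd'
      obtain ⟨κ, rfl⟩ := hne
      simp [map_sum]
    · change (Nat.card {κ : G.Coloring ℕ //
          ∑ v, Finsupp.single (κ v) (w v : ℕ) = d.mapDomain σ} : K) =
        (Nat.card {κ : G.Coloring ℕ // ∑ v, Finsupp.single (κ v) (w v : ℕ) = d} : K)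
      congr 1
      let τ : (⊤ : SimpleGraph ℕ) ≃g (⊤ : SimpleGraph ℕ) := SimpleGraph.Iso.completeGraph σ
      let e : G.Coloring ℕ ≃ G.Coloring ℕ :=
        { toFun := fun κ => τ.toHom.comp κ
          invFun := fun κ => τ.symm.toHom.comp κ
          left_inv := fun κ => by ext v; exact σ.symm_apply_apply _
          right_inv := fun κ => by ext v; exact σ.apply_symm_apply _ }
      refine (Nat.card_congr (e.subtypeEquiv fun κ => ?_)).symm
      have : ∑ v, Finsupp.single (e κ v) (w v : ℕ) =
          (∑ v, Finsupp.single (κ v) (w v : ℕ)).mapDomain σ := by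
        rw [Finsupp.mapDomain_finsetSum]
        refine Finset.sum_congr rfl fun v _ => ?_
        rw [Finsupp.mapDomain_single]; rfl
      rw [this]
      exact (Finsupp.mapDomain_injective σ.injective).eq_iff.symm⟩

/-- Only finitely many colourings contribute to a given coefficient of `X_G`. -/
theorem finite_colorings {V : Type*} [Fintype V] (G : SimpleGraph V) (w : V → ℕ+) (d : ℕ →₀ ℕ) :
    Finite {κ : G.Coloring ℕ // ∑ v, Finsupp.single (κ v) (w v : ℕ) = d} := by
  refine Finite.of_injective (β := V → d.support) (fun κ v => ⟨κ.1 v, ?_⟩) ?_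
  · rw [Finsupp.mem_support_iff]
    intro h
    rw [← DFunLike.congr_fun κ.2, Finsupp.finsetSum_apply] at h
    have := (Finset.sum_eq_zero_iff.1 h) v (Finset.mem_univ v)
    simp at this
  · intro κ κ' h
    ext v
    exact congrArg Subtype.val (congrFun h v)


/-! ### The augmented monomial symmetric functions form a basis -/

theorem coeff_psum_mul (n : ℕ+) (f : MvPowerSeries ℕ K) (d : ℕ →₀ ℕ) :
    MvPowerSeries.coeff d ((psum K n : MvPowerSeries ℕ K) * f) =
      ∑ i ∈ d.support, if (n : ℕ) ≤ d i then
        MvPowerSeries.coeff (d - Finsupp.single i (n : ℕ)) f else 0 := by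
  classical
  rw [MvPowerSeries.coeff_mul, ← Finset.sum_filter]
  have hp : ∀ a : ℕ →₀ ℕ, MvPowerSeries.coeff a (psum K n : MvPowerSeries ℕ K) =
      if ∃ i : ℕ, a = Finsupp.single i (n : ℕ) then 1 else 0 := fun a => by
    change (if ∃ i : ℕ, a = Finsupp.single i (n : ℕ) then (1 : K) else 0) = _
    rfl
  have hn : (n : ℕ) ≠ 0 := n.ne_zero
  simp_rw [hp, ite_mul, one_mul, zero_mul]
  rw [← Finset.sum_filter]
  symm
  refine Finset.sum_bij (fun i _ => (Finsupp.single i (n : ℕ), d - Finsupp.single i (n : ℕ)))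
    ?_ ?_ ?_ ?_
  · intro i hi
    rw [Finset.mem_filter] at hi ⊢
    refine ⟨?_, i, rfl⟩
    rw [Finset.HasAntidiagonal.mem_antidiagonal]
    exact add_tsub_cancel_of_le (Finsupp.single_le_iff.2 hi.2)
  · intro i _ j _ h
    exact (Finsupp.single_left_inj hn).1 (Prod.ext_iff.1 h).1
  · rintro ⟨a, b⟩ hab
    rw [Finset.mem_filter, Finset.HasAntidiagonal.mem_antidiagonal] at hab
    obtain ⟨hab, i, hi⟩ := hab
    dsimp only at hab hi
    subst hi
    have hle : (n : ℕ) ≤ d i := by rw [← hab]; simp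
    refine ⟨i, ?_, ?_⟩
    · rw [Finset.mem_filter, Finsupp.mem_support_iff]
      exact ⟨by omega, hle⟩
    · rw [← hab, add_tsub_cancel_left]
  · intro i _
    rfl


/-- The linear map sending the monomial `∏ k, X k ^ r k` to `m̃_r`. -/
def mtildeLin (K : Type*) [Field K] : MvPolynomial ℕ+ K →ₗ[K] Lambda K :=
  (MvPolynomial.basisMonomials ℕ+ K).constr K (mtilde K)

theorem mtildeLin_monomial (r : ℕ+ →₀ ℕ) :
    mtildeLin K (MvPolynomial.monomial r 1) = mtilde K r := by
  have := (MvPolynomial.basisMonomials ℕ+ K).constr_basis K (mtilde K) r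
  rwa [MvPolynomial.coe_basisMonomials] at this

theorem coeff_mtildeLin (g : MvPolynomial ℕ+ K) (d : ℕ →₀ ℕ) :
    MvPowerSeries.coeff d (mtildeLin K g : MvPowerSeries ℕ K) =
      g.coeff (expType d) * factProd (expType d) := by
  induction g using MvPolynomial.induction_on' with
  | monomial r a =>
    have : MvPolynomial.monomial r a = a • MvPolynomial.monomial r (1 : K) := by
      rw [MvPolynomial.smul_monomial, smul_eq_mul, mul_one]
    rw [this, map_smul, mtildeLin_monomial, MvPolynomial.coeff_smul, MvPolynomial.coeff_monomial]
    change MvPowerSeries.coeff d (a • (mtilde K r : MvPowerSeries ℕ K)) = _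
    rw [MvPowerSeries.coeff_smul, coeff_mtilde]
    by_cases h : expType d = r
    · simp [h]
    · simp [h, Ne.symm h]
  | add p q hp hq =>
    rw [map_add, MvPolynomial.coeff_add, add_mul, ← hp, ← hq]
    exact map_add _ _ _

theorem exists_expType_eq (r : ℕ+ →₀ ℕ) : ∃ d, expType d = r := by
  induction r using Finsupp.induction_linear with
  | zero => exact ⟨0, by simp [expType]⟩
  | add f g hf hg =>
    obtain ⟨a, rfl⟩ := hf
    obtain ⟨b, rfl⟩ := hg
    obtain ⟨N, hN⟩ := a.support.exists_nat_subset_range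
    have hinj : Function.Injective (fun i : ℕ => i + N) := add_left_injective N
    have hdisj : Disjoint a.support (b.mapDomain fun i => i + N).support := by
      rw [Finset.disjoint_left]
      intro i hi hi'
      have h1 := Finset.mem_range.1 (hN hi)
      obtain ⟨j, -, rfl⟩ := Finset.mem_image.1 (Finsupp.mapDomain_support hi')
      omega
    refine ⟨a + b.mapDomain fun i => i + N, ?_⟩
    rw [expType, Finsupp.sum_add_index_of_disjoint hdisj, Finsupp.sum_mapDomain_index_inj hinj]
    rfl
  | single k m =>
    refine ⟨∑ i ∈ Finset.range m, Finsupp.single i (k : ℕ), ?_⟩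
    ext j
    have hd : ∀ i, (∑ i ∈ Finset.range m, Finsupp.single i (k : ℕ)) i =
        if i < m then (k : ℕ) else 0 := by
      intro i
      simp [Finsupp.finsetSum_apply, Finsupp.single_apply]
    rw [expType_apply, Finsupp.single_apply]
    by_cases hkj : k = j
    · subst hkj
      have : (∑ i ∈ Finset.range m, Finsupp.single i (k : ℕ)).support.filter
          (fun i => (∑ i ∈ Finset.range m, Finsupp.single i (k : ℕ)) i = k) = Finset.range m := by
        ext i
        rw [Finset.mem_filter, Finsupp.mem_support_iff, hd, Finset.mem_range]
        by_cases h : i < m <;> simp [h]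
      rw [this]; simp
    · rw [if_neg hkj, Finset.card_eq_zero, Finset.filter_eq_empty_iff]
      intro i hi hij
      rw [Finsupp.mem_support_iff] at hi
      rw [hd] at hi hij
      by_cases h : i < m
      · rw [if_pos h] at hij
        exact hkj (PNat.coe_inj.1 hij)
      · exact hi (if_neg h)

theorem exists_perm_of_expType_eq {d e : ℕ →₀ ℕ} (h : expType d = expType e) :
    ∃ σ : Equiv.Perm ℕ, d.mapDomain σ = e := by
  have key : ∀ k : ℕ, Nonempty ({i // d i = k} ≃ {i // e i = k}) := by
    intro k
    rcases Nat.eq_zero_or_pos k with rfl | hk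
    · have hinf : ∀ f : ℕ →₀ ℕ, Infinite {i // f i = 0} := by
        intro f
        have : {i | f i = 0} = (f.support : Set ℕ)ᶜ := by ext i; simp
        have h2 : {i | f i = 0}.Infinite := by
          rw [this]; exact f.support.finite_toSet.infinite_compl
        exact h2.to_subtype
      have := hinf d
      have := hinf e
      exact ⟨(Denumerable.ofEncodableOfInfinite _).eqv.trans
        (Denumerable.ofEncodableOfInfinite _).eqv.symm⟩
    · obtain ⟨k, rfl⟩ : ∃ k' : ℕ+, (k' : ℕ) = k := ⟨⟨k, hk⟩, rfl⟩
      have hcard : expType d k = expType e k := by rw [h]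
      rw [expType_apply, expType_apply] at hcard
      have hmem : ∀ (f : ℕ →₀ ℕ) (i : ℕ),
          i ∈ f.support.filter (fun i => f i = (k : ℕ)) ↔ f i = (k : ℕ) := by
        intro f i
        rw [Finset.mem_filter, Finsupp.mem_support_iff]
        exact ⟨fun h => h.2, fun h => ⟨by omega, h⟩⟩
      exact ⟨((Equiv.subtypeEquivRight (hmem d)).symm.trans
        (Finset.equivOfCardEq hcard)).trans (Equiv.subtypeEquivRight (hmem e))⟩
  let φ := fun k => (key k).some
  let σ : Equiv.Perm ℕ := (Equiv.sigmaFiberEquiv d).symm.trans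
    ((Equiv.sigmaCongrRight φ).trans (Equiv.sigmaFiberEquiv e))
  have hσ : ∀ i, e (σ i) = d i := fun i => (φ (d i) ⟨i, rfl⟩).2
  refine ⟨σ, ?_⟩
  ext j
  obtain ⟨i, rfl⟩ := σ.surjective j
  rw [Finsupp.mapDomain_apply σ.injective, hσ]

theorem finite_size_le (N : ℕ) : {r : ℕ+ →₀ ℕ | size r ≤ N}.Finite := by
  refine ((Set.finite_le_nat N).preimage (f := fun k : ℕ+ => (k : ℕ))
    PNat.coe_injective.injOn).toFinset.finsupp (fun _ => Finset.range (N + 1)) |>.finite_toSet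
    |>.subset ?_
  intro r hr
  have hk : ∀ k, r k * (k : ℕ) ≤ N := by
    intro k
    by_cases h : r k = 0
    · simp [h]
    · exact (Finset.single_le_sum (f := fun k => r k * (k : ℕ)) (fun _ _ => Nat.zero_le _)
        (Finsupp.mem_support_iff.2 h)).trans hr
  rw [Finset.mem_coe, Finset.mem_finsupp_iff]
  refine ⟨fun k hk' => ?_, fun k _ => ?_⟩
  · have h1 : 1 ≤ r k := Nat.one_le_iff_ne_zero.2 (Finsupp.mem_support_iff.1 hk')
    simp only [Set.Finite.mem_toFinset, Set.mem_preimage, Set.mem_ofPred_eq]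
    nlinarith [hk k]
  · rw [Finset.mem_range]
    nlinarith [hk k, k.pos]

theorem expType_eq_erase (d : ℕ →₀ ℕ) (i : ℕ) (k : ℕ+) (h : d i = k) :
    expType d = expType (d.erase i) + Finsupp.single k 1 := by
  have hi : i ∈ d.support := by
    rw [Finsupp.mem_support_iff, h]
    exact k.ne_zero
  rw [expType, ← Finsupp.add_sum_erase d i _ hi, h, PNat.coe_toPNat', add_comm]
  rfl

theorem factProd_add_single (r : ℕ+ →₀ ℕ) (k : ℕ+) :
    factProd (r + Finsupp.single k 1) = (r k + 1) * factProd r := by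
  have h : ∀ s : ℕ+ →₀ ℕ, factProd s = (s k).factorial * (s.erase k).prod fun _ m => m.factorial := by
    intro s
    exact (Finsupp.mul_prod_erase' s k _ (fun _ => rfl)).symm
  rw [h, h r, Finsupp.erase_add, Finsupp.erase_single, add_zero, Finsupp.add_apply,
    Finsupp.single_eq_same, Nat.factorial_succ, mul_assoc]

/-- The derivation `X k ↦ X (k + n)`, which describes multiplication by `p_n` on the
augmented monomial symmetric functions. -/
def shiftDer (K : Type*) [Field K] (n : ℕ+) :
    Derivation K (MvPolynomial ℕ+ K) (MvPolynomial ℕ+ K) :=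
  MvPolynomial.mkDerivation K fun k => MvPolynomial.X (k + n)

theorem coeff_shiftDer_monomial (n : ℕ+) (r s : ℕ+ →₀ ℕ) :
    (shiftDer K n (MvPolynomial.monomial r 1)).coeff s =
      ∑ j ∈ r.support, if r - Finsupp.single j 1 + Finsupp.single (j + n) 1 = s
        then (r j : K) else 0 := by
  rw [shiftDer, MvPolynomial.mkDerivation_monomial, one_smul, Finsupp.sum,
    MvPolynomial.coeff_sum]
  refine Finset.sum_congr rfl fun j _ => ?_
  rw [smul_eq_mul, MvPolynomial.X, MvPolynomial.monomial_mul, mul_one, MvPolynomial.coeff_monomial]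

variable [CharZero K]

set_option linter.unusedSectionVars false

theorem mtildeLin_injective : Function.Injective (mtildeLin K) := by
  intro f g hfg
  ext r
  obtain ⟨d, rfl⟩ := exists_expType_eq r
  have := coeff_mtildeLin f d
  rw [hfg, coeff_mtildeLin] at this
  exact (mul_right_cancel₀ (Nat.cast_ne_zero.2 (factProd_ne_zero _)) this).symm

theorem mtildeLin_surjective : Function.Surjective (mtildeLin K) := by
  intro f
  choose rep hrep using exists_expType_eq
  obtain ⟨N, hN⟩ := f.2.2
  let c : (ℕ+ →₀ ℕ) → K := fun r =>
    MvPowerSeries.coeff (rep r) (f : MvPowerSeries ℕ K) / factProd r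
  have hfin : (Function.support c).Finite := by
    refine (finite_size_le N).subset fun r hr => ?_
    have : MvPowerSeries.coeff (rep r) (f : MvPowerSeries ℕ K) ≠ 0 := by
      intro h
      simp [c, h] at hr
    have := hN _ this
    rwa [← size_expType, hrep] at this
  let g : MvPolynomial ℕ+ K := ∑ r ∈ hfin.toFinset, MvPolynomial.monomial r (c r)
  have hg : ∀ r, g.coeff r = c r := by
    intro r
    simp only [g, MvPolynomial.coeff_sum, MvPolynomial.coeff_monomial]
    rw [Finset.sum_ite_eq' hfin.toFinset r c]
    by_cases h : r ∈ hfin.toFinset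
    · rw [if_pos h]
    · rw [if_neg h]
      by_contra h'
      exact h (hfin.mem_toFinset.2 (Ne.symm h'))
  refine ⟨g, Subtype.ext (MvPowerSeries.ext fun d => ?_)⟩
  rw [coeff_mtildeLin, hg, div_mul_cancel₀ _ (Nat.cast_ne_zero.2 (factProd_ne_zero _))]
  obtain ⟨σ, hσ⟩ := exists_perm_of_expType_eq (hrep (expType d))
  conv_rhs => rw [← hσ, coeff_mapDomain f.2]

/-- The linear isomorphism sending the monomial `∏ k, X k ^ r k` to `m̃_r`. -/
def mtildeEquiv (K : Type*) [Field K] [CharZero K] : MvPolynomial ℕ+ K ≃ₗ[K] Lambda K :=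
  LinearEquiv.ofBijective (mtildeLin K) ⟨mtildeLin_injective, mtildeLin_surjective⟩

/-! ### The power sums are algebraically independent generators -/



theorem psum_mul_aux (n : ℕ+) (r s : ℕ+ →₀ ℕ) :
    ∑ k ∈ s.support, (s k : K) *
      ((if s = r + Finsupp.single n 1 ∧ k = n then (factProd r : K) else 0) +
        (if n < k ∧ s + Finsupp.single (k - n) 1 = r + Finsupp.single k 1 then
          (factProd r : K) else 0)) =
    ((MvPolynomial.X n * MvPolynomial.monomial r (1 : K)).coeff s +
      ∑ j ∈ r.support, if r - Finsupp.single j 1 + Finsupp.single (j + n) 1 = s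
        then (r j : K) else 0) * factProd s := by
  simp_rw [mul_add]
  rw [Finset.sum_add_distrib, add_mul]
  congr 1
  · rw [MvPolynomial.X, MvPolynomial.monomial_mul, mul_one, MvPolynomial.coeff_monomial]
    by_cases h : s = r + Finsupp.single n 1
    · have hn : n ∈ s.support := by
        rw [Finsupp.mem_support_iff, h, Finsupp.add_apply, Finsupp.single_eq_same]
        omega
      rw [Finset.sum_eq_single_of_mem n hn (fun k _ hk => by simp [hk]),
        if_pos ⟨h, rfl⟩, if_pos (by rw [h, add_comm]), one_mul, h, factProd_add_single]
      simp
    · have h' : ¬ Finsupp.single n 1 + r = s := fun h' => h (by rw [← h', add_comm])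
      simp [h, h']
  · rw [Finset.sum_mul]
    symm
    refine Finset.sum_bij_ne_zero (fun j _ _ => j + n) ?_ ?_ ?_ ?_
    · intro j _ hne
      have h : r - Finsupp.single j 1 + Finsupp.single (j + n) 1 = s := by
        by_contra h
        simp [h] at hne
      rw [Finsupp.mem_support_iff, ← h, Finsupp.add_apply, Finsupp.single_eq_same]
      omega
    · intro j _ _ j' _ _ h
      exact add_right_cancel h
    · intro k hk hne
      have h : n < k ∧ s + Finsupp.single (k - n) 1 = r + Finsupp.single k 1 := by
        by_contra h
        simp [h] at hne
      obtain ⟨hnk, h⟩ := h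
      have hkn : k - n + n = k := PNat.sub_add_of_lt hnk
      have hkne : k - n ≠ k := by
        intro h
        rw [h] at hkn
        exact (PNat.lt_add_right k n).ne hkn.symm
      have hr : r (k - n) = s (k - n) + 1 := by
        have := DFunLike.congr_fun h (k - n)
        simpa [Finsupp.single_apply, hkne.symm] using this.symm
      have hs : r - Finsupp.single (k - n) 1 + Finsupp.single (k - n + n) 1 = s := by
        rw [hkn]
        ext l
        have := DFunLike.congr_fun h l
        simp only [Finsupp.add_apply, Finsupp.tsub_apply] at this ⊢
        by_cases hl : l = k - n
        · subst hl
          simp only [Finsupp.single_eq_same] at this ⊢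
          omega
        · simp only [Finsupp.single_eq_of_ne hl] at this ⊢
          omega
      refine ⟨k - n, ?_, ?_, hkn⟩
      · rw [Finsupp.mem_support_iff, hr]
        omega
      · rw [if_pos hs]
        exact mul_ne_zero (Nat.cast_ne_zero.2 (by omega))
          (Nat.cast_ne_zero.2 (factProd_ne_zero s))
    · intro j hj hne
      have h : r - Finsupp.single j 1 + Finsupp.single (j + n) 1 = s := by
        by_contra h
        simp [h] at hne
      have hrj : r - Finsupp.single j 1 + Finsupp.single j 1 = r := by
        refine tsub_add_cancel_of_le (Finsupp.single_le_iff.2 ?_)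
        exact Nat.one_le_iff_ne_zero.2 (Finsupp.mem_support_iff.1 hj)
      have hlt : n < j + n := PNat.lt_add_left n j
      have hsub : j + n - n = j := by
        apply PNat.coe_injective
        rw [PNat.sub_coe, if_pos hlt, PNat.add_coe, Nat.add_sub_cancel]
      generalize r - Finsupp.single j 1 = t at h hrj
      rw [if_pos h, if_pos]
      · rw [← h, ← hrj, factProd_add_single, factProd_add_single]
        simp only [Finsupp.add_apply, Finsupp.single_eq_same]
        push_cast
        ring
      · refine ⟨hlt, ?_⟩
        rw [hsub, ← h, ← hrj, add_right_comm]

theorem psum_mul_mtilde (n : ℕ+) (r : ℕ+ →₀ ℕ) :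
    psum K n * mtilde K r = mtildeLin K (MvPolynomial.X n * MvPolynomial.monomial r 1 +
      shiftDer K n (MvPolynomial.monomial r 1)) := by
  refine Subtype.ext (MvPowerSeries.ext fun d => ?_)
  rw [MulMemClass.coe_mul, coeff_psum_mul, coeff_mtildeLin, MvPolynomial.coeff_add,
    coeff_shiftDer_monomial]
  simp_rw [coeff_mtilde]
  let F : ℕ+ → K := fun k =>
    (if expType d = r + Finsupp.single n 1 ∧ k = n then (factProd r : K) else 0) +
    (if n < k ∧ expType d + Finsupp.single (k - n) 1 = r + Finsupp.single k 1 then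
      (factProd r : K) else 0)
  have h1 : ∀ i ∈ d.support, (if (n : ℕ) ≤ d i then
      (if expType (d - Finsupp.single i (n : ℕ)) = r then (factProd r : K) else 0) else 0) =
      F (d i).toPNat' := by
    intro i hi
    obtain ⟨k, hk⟩ : ∃ k : ℕ+, (k : ℕ) = d i :=
      ⟨⟨d i, Nat.pos_of_ne_zero (Finsupp.mem_support_iff.1 hi)⟩, rfl⟩
    rw [← hk, PNat.coe_toPNat']
    have hd := expType_eq_erase d i k hk.symm
    have her : (d - Finsupp.single i (n : ℕ)).erase i = d.erase i := by
      ext j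
      by_cases hj : j = i
      · subst hj; simp
      · simp [Finsupp.erase_ne hj, Ne.symm hj]
    rcases lt_trichotomy n k with h | h | h
    · have hk' : (d - Finsupp.single i (n : ℕ)) i = (k - n : ℕ+) := by
        rw [PNat.sub_coe, if_pos h, Finsupp.tsub_apply, Finsupp.single_eq_same, hk]
      have he := expType_eq_erase _ i _ hk'
      rw [her] at he
      have hne : k ≠ n := h.ne'
      have hle : (n : ℕ) ≤ k := PNat.coe_le_coe _ _ |>.2 h.le
      simp only [F, hne, h, and_false, if_false, true_and, zero_add, hle, if_true]
      refine if_congr ?_ rfl rfl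
      rw [he, hd, add_right_comm, add_left_inj]
    · subst h
      have he : d - Finsupp.single i (n : ℕ) = d.erase i := by
        rw [← her]
        ext j
        by_cases hj : j = i
        · subst hj; simp [hk]
        · simp [Finsupp.erase_ne hj]
      simp only [F, le_refl, if_true, and_true, lt_irrefl, false_and, if_false, add_zero]
      rw [he]
      refine if_congr ?_ rfl rfl
      rw [hd, add_left_inj]
    · have hne : k ≠ n := h.ne
      have hle : ¬ (n : ℕ) ≤ k := fun h' => absurd h (not_lt.2 ((PNat.coe_le_coe _ _).1 h'))
      simp [F, hne, hle, not_lt.2 h.le]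
  rw [Finset.sum_congr rfl h1]
  have h2 : ∑ i ∈ d.support, F (d i).toPNat' =
      ∑ k ∈ (expType d).support, (expType d k : K) * F k := by
    have := Finsupp.sum_finsetSum_index (s := d.support)
      (g := fun i => Finsupp.single (d i).toPNat' 1)
      (h := fun (k : ℕ+) (m : ℕ) => (m : K) * F k) (by simp) (by intros; push_cast; ring)
    simp only [Nat.cast_zero, zero_mul, Finsupp.sum_single_index, Nat.cast_one, one_mul] at this
    exact this
  rw [h2]
  exact psum_mul_aux n r (expType d)

theorem mtilde_zero : mtilde K 0 = 1 := by
  refine Subtype.ext (MvPowerSeries.ext fun d => ?_)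
  rw [coeff_mtilde, OneMemClass.coe_one, MvPowerSeries.coeff_one]
  have h : expType d = 0 ↔ d = 0 := by
    constructor
    · intro h
      rw [← Finsupp.degree_eq_zero_iff, ← size_expType, h]
      simp [size]
    · rintro rfl
      simp [expType]
  simp [h, factProd]

theorem psum_eq_mtilde (n : ℕ+) : psum K n = mtilde K (Finsupp.single n 1) := by
  have := psum_mul_mtilde (K := K) n 0
  rwa [mtilde_zero, mul_one, MvPolynomial.monomial_zero', map_one, Derivation.map_one_eq_zero,
    mul_one, add_zero, MvPolynomial.X, mtildeLin_monomial] at this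

theorem psum_mul_mtildeLin (n : ℕ+) (g : MvPolynomial ℕ+ K) :
    psum K n * mtildeLin K g = mtildeLin K (MvPolynomial.X n * g + shiftDer K n g) := by
  have : LinearMap.mulLeft K (psum K n) ∘ₗ mtildeLin K = mtildeLin K ∘ₗ
      (LinearMap.mulLeft K (MvPolynomial.X n) + (shiftDer K n : _ →ₗ[K] _)) :=
    (MvPolynomial.basisMonomials ℕ+ K).ext fun r => by
      rw [MvPolynomial.coe_basisMonomials]
      simpa [mtildeLin_monomial] using psum_mul_mtilde (K := K) n r
  exact LinearMap.congr_fun this g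

/-- The algebra morphism sending `X n` to `p_n`. -/
def psumHom (K : Type*) [Field K] : MvPolynomial ℕ+ K →ₐ[K] Lambda K :=
  MvPolynomial.aeval (psum K)

/-- The change of basis from the augmented monomial to the power sum symmetric functions. -/
def transition (K : Type*) [Field K] [CharZero K] : MvPolynomial ℕ+ K →ₗ[K] MvPolynomial ℕ+ K :=
  (mtildeEquiv K).symm.toLinearMap ∘ₗ (psumHom K).toLinearMap

theorem mtildeLin_transition (f : MvPolynomial ℕ+ K) :
    mtildeLin K (transition K f) = psumHom K f :=
  (mtildeEquiv K).apply_symm_apply _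

theorem transition_one : transition K 1 = 1 := by
  refine mtildeLin_injective ?_
  rw [mtildeLin_transition, map_one, ← mtilde_zero, ← mtildeLin_monomial]
  rfl

theorem transition_X_mul (n : ℕ+) (f : MvPolynomial ℕ+ K) :
    transition K (MvPolynomial.X n * f) =
      MvPolynomial.X n * transition K f + shiftDer K n (transition K f) := by
  refine mtildeLin_injective ?_
  rw [mtildeLin_transition, map_mul, ← psum_mul_mtildeLin, mtildeLin_transition, psumHom,
    MvPolynomial.aeval_X]

/-- The span of the monomials of degree less than `k`. -/
def lowDeg (K : Type*) [Field K] (k : ℕ) : Submodule K (MvPolynomial ℕ+ K) :=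
  Submodule.span K {f | ∃ r : ℕ+ →₀ ℕ, r.degree < k ∧ f = MvPolynomial.monomial r 1}

theorem lowDeg_mono {k l : ℕ} (h : k ≤ l) : lowDeg K k ≤ lowDeg K l :=
  Submodule.span_mono fun _ ⟨r, hr, hf⟩ => ⟨r, hr.trans_le h, hf⟩

theorem X_mul_mem_lowDeg (n : ℕ+) {k : ℕ} {f : MvPolynomial ℕ+ K} (hf : f ∈ lowDeg K k) :
    MvPolynomial.X n * f ∈ lowDeg K (k + 1) := by
  have : lowDeg K k ≤ (lowDeg K (k + 1)).comap (LinearMap.mulLeft K (MvPolynomial.X n)) := by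
    refine Submodule.span_le.2 ?_
    rintro _ ⟨r, hr, rfl⟩
    refine Submodule.subset_span ⟨Finsupp.single n 1 + r, ?_, ?_⟩
    · simp; omega
    · simp [MvPolynomial.X, MvPolynomial.monomial_mul]
  exact this hf

theorem shiftDer_mem_lowDeg (n : ℕ+) {k : ℕ} {f : MvPolynomial ℕ+ K} (hf : f ∈ lowDeg K k) :
    shiftDer K n f ∈ lowDeg K k := by
  have : lowDeg K k ≤ (lowDeg K k).comap (shiftDer K n : _ →ₗ[K] _) := by
    refine Submodule.span_le.2 ?_
    rintro _ ⟨r, hr, rfl⟩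
    change shiftDer K n (MvPolynomial.monomial r 1) ∈ lowDeg K k
    rw [shiftDer, MvPolynomial.mkDerivation_monomial, one_smul, Finsupp.sum]
    refine Submodule.sum_mem _ fun j hj => ?_
    have hle : Finsupp.single j 1 ≤ r := Finsupp.single_le_iff.2
      (Nat.one_le_iff_ne_zero.2 (Finsupp.mem_support_iff.1 hj))
    have hdeg := congrArg Finsupp.degree (tsub_add_cancel_of_le hle)
    have hmul : MvPolynomial.monomial (r - Finsupp.single j 1) (r j : K) •
        (MvPolynomial.X (j + n) : MvPolynomial ℕ+ K) = (r j : K) •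
        MvPolynomial.monomial (r - Finsupp.single j 1 + Finsupp.single (j + n) 1) 1 := by
      simp [MvPolynomial.X, MvPolynomial.monomial_mul, MvPolynomial.smul_monomial]
    rw [hmul]
    refine Submodule.smul_mem _ _ (Submodule.subset_span ⟨_, ?_, rfl⟩)
    simp only [map_add, Finsupp.degree_single] at hdeg ⊢
    omega
  exact this hf

theorem transition_monomial_sub (r : ℕ+ →₀ ℕ) :
    transition K (MvPolynomial.monomial r 1) - MvPolynomial.monomial r 1 ∈
      lowDeg K r.degree := by
  induction hd : r.degree generalizing r with
  | zero =>
    rw [Finsupp.degree_eq_zero_iff] at hd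
    subst hd
    rw [MvPolynomial.monomial_zero', map_one, transition_one, sub_self]
    exact zero_mem _
  | succ k ih =>
    obtain ⟨n, hn⟩ : ∃ n, r n ≠ 0 := by
      by_contra! h
      have : r = 0 := Finsupp.ext h
      simp [this] at hd
    have hle : Finsupp.single n 1 ≤ r := Finsupp.single_le_iff.2 (Nat.one_le_iff_ne_zero.2 hn)
    obtain ⟨t, rfl⟩ := exists_add_of_le hle
    have hdt : t.degree = k := by
      simp only [map_add, Finsupp.degree_single] at hd
      omega
    have hm : MvPolynomial.monomial (Finsupp.single n 1 + t) (1 : K) =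
        MvPolynomial.X n * MvPolynomial.monomial t 1 := by
      simp [MvPolynomial.X, MvPolynomial.monomial_mul]
    have h1 := ih t hdt
    have h2 : MvPolynomial.monomial t (1 : K) ∈ lowDeg K (k + 1) :=
      Submodule.subset_span ⟨t, by omega, rfl⟩
    have h3 : transition K (MvPolynomial.monomial t 1) ∈ lowDeg K (k + 1) := by
      have := add_mem (lowDeg_mono (Nat.le_succ k) h1) h2
      rwa [sub_add_cancel] at this
    rw [hm, transition_X_mul, add_sub_right_comm, ← mul_sub]
    exact add_mem (X_mul_mem_lowDeg n h1) (shiftDer_mem_lowDeg n h3)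

theorem transition_sub_mem {k : ℕ} {f : MvPolynomial ℕ+ K} (hf : f ∈ lowDeg K (k + 1)) :
    transition K f - f ∈ lowDeg K k := by
  have : lowDeg K (k + 1) ≤ (lowDeg K k).comap (transition K - LinearMap.id) := by
    refine Submodule.span_le.2 ?_
    rintro _ ⟨r, hr, rfl⟩
    exact lowDeg_mono (Nat.lt_succ_iff.1 hr) (transition_monomial_sub r)
  exact this hf

theorem exists_mem_lowDeg (f : MvPolynomial ℕ+ K) : ∃ k, f ∈ lowDeg K k := by
  induction f using MvPolynomial.induction_on' with
  | monomial r a =>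
    refine ⟨r.degree + 1, ?_⟩
    have : MvPolynomial.monomial r a = a • MvPolynomial.monomial r (1 : K) := by
      rw [MvPolynomial.smul_monomial, smul_eq_mul, mul_one]
    rw [this]
    exact Submodule.smul_mem _ _ (Submodule.subset_span ⟨r, Nat.lt_succ_self _, rfl⟩)
  | add p q hp hq =>
    obtain ⟨k, hk⟩ := hp
    obtain ⟨l, hl⟩ := hq
    exact ⟨max k l, add_mem (lowDeg_mono (le_max_left _ _) hk) (lowDeg_mono (le_max_right _ _) hl)⟩

theorem lowDeg_zero : lowDeg K 0 = ⊥ := by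
  simp [lowDeg]

theorem transition_bijective : Function.Bijective (transition K) := by
  constructor
  · rw [injective_iff_map_eq_zero]
    intro f hf
    obtain ⟨k, hk⟩ := exists_mem_lowDeg f
    induction k with
    | zero => rwa [lowDeg_zero, Submodule.mem_bot] at hk
    | succ k ih =>
      have := transition_sub_mem hk
      rw [hf, zero_sub, neg_mem_iff] at this
      exact ih this
  · intro f
    obtain ⟨k, hk⟩ := exists_mem_lowDeg f
    induction k generalizing f with
    | zero =>
      rw [lowDeg_zero, Submodule.mem_bot] at hk
      exact ⟨0, by rw [hk, map_zero]⟩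
    | succ k ih =>
      obtain ⟨g, hg⟩ := ih _ (transition_sub_mem hk)
      exact ⟨f - g, by rw [map_sub, hg, sub_sub_cancel]⟩

theorem psumHom_bijective : Function.Bijective (psumHom K) := by
  have : (psumHom K : MvPolynomial ℕ+ K → Lambda K) = mtildeEquiv K ∘ transition K :=
    funext fun f => (mtildeLin_transition f).symm
  rw [this]
  exact (mtildeEquiv K).bijective.comp transition_bijective

/-- The algebra isomorphism sending `X n` to `p_n`. -/
def psumEquiv (K : Type*) [Field K] [CharZero K] : MvPolynomial ℕ+ K ≃ₐ[K] Lambda K :=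
  AlgEquiv.ofBijective (psumHom K) psumHom_bijective

theorem psumEquiv_X (n : ℕ+) : psumEquiv K (MvPolynomial.X n) = psum K n :=
  MvPolynomial.aeval_X _ _

theorem psumEquiv_symm_psum (n : ℕ+) : (psumEquiv K).symm (psum K n) = MvPolynomial.X n := by
  rw [← psumEquiv_X, AlgEquiv.symm_apply_apply]

theorem Lambda_algHom_ext {A : Type*} [Semiring A] [Algebra K A] {f g : Lambda K →ₐ[K] A}
    (h : ∀ n, f (psum K n) = g (psum K n)) : f = g := by
  have : f.comp (psumEquiv K : MvPolynomial ℕ+ K →ₐ[K] Lambda K) =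
      g.comp (psumEquiv K : MvPolynomial ℕ+ K →ₐ[K] Lambda K) :=
    MvPolynomial.algHom_ext fun n => by simpa [psumEquiv_X] using h n
  ext1 x
  obtain ⟨y, rfl⟩ := (psumEquiv K).surjective x
  exact DFunLike.congr_fun this y

/-! ### The Hopf algebra `Λ` -/

/-- The algebra morphism `Λ → A` sending each `p_n` to `a n`. -/
def liftPsum {A : Type*} [CommSemiring A] [Algebra K A] (a : ℕ+ → A) : Lambda K →ₐ[K] A :=
  (MvPolynomial.aeval a).comp ((psumEquiv K).symm : Lambda K →ₐ[K] MvPolynomial ℕ+ K)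

theorem liftPsum_psum {A : Type*} [CommSemiring A] [Algebra K A] (a : ℕ+ → A) (n : ℕ+) :
    liftPsum a (psum K n) = a n := by
  simp [liftPsum, psumEquiv_symm_psum]

/-- The bialgebra `Λ`: every `p_n` is primitive, i.e. `Δ p_n = p_n ⊗ 1 + 1 ⊗ p_n`, `ε p_n = 0`. -/
instance : Bialgebra K (Lambda K) :=
  Bialgebra.ofAlgHom
    (liftPsum fun n => psum K n ⊗ₜ[K] (1 : Lambda K) + (1 : Lambda K) ⊗ₜ[K] psum K n)
    (liftPsum fun _ => 0)
    (Lambda_algHom_ext fun n => by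
      simp [liftPsum_psum, Algebra.TensorProduct.one_def, TensorProduct.add_tmul,
        TensorProduct.tmul_add]
      abel)
    (Lambda_algHom_ext fun n => by simp [liftPsum_psum])
    (Lambda_algHom_ext fun n => by simp [liftPsum_psum])

theorem comul_psum (n : ℕ+) : Coalgebra.comul (R := K) (psum K n) =
    psum K n ⊗ₜ[K] (1 : Lambda K) + (1 : Lambda K) ⊗ₜ[K] psum K n :=
  liftPsum_psum _ n

theorem counit_psum (n : ℕ+) : Coalgebra.counit (R := K) (psum K n) = 0 :=
  liftPsum_psum (fun _ => (0 : K)) n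

/-- The Hopf algebra `Λ`, with antipode `p_n ↦ -p_n`. -/
instance : HopfAlgebra K (Lambda K) :=
  HopfAlgebra.ofAlgHom (liftPsum fun n => -psum K n)
    (Lambda_algHom_ext fun n => by
      rw [AlgHom.comp_apply, Bialgebra.comulAlgHom_apply, comul_psum, map_add]
      refine (congrArg₂ (· + ·)
        (Algebra.TensorProduct.lift_tmul _ _ (fun _ _ => Commute.all _ _) _ _)
        (Algebra.TensorProduct.lift_tmul _ _ (fun _ _ => Commute.all _ _) _ _)).trans ?_
      simp [counit_psum, liftPsum_psum])
    (Lambda_algHom_ext fun n => by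
      simp [comul_psum, counit_psum, Algebra.TensorProduct.lift_tmul, liftPsum_psum])

/-! ### The coproduct on the augmented monomial symmetric functions -/

/-- The coproduct on the polynomial algebra for which all variables are primitive. -/
def polyComul (K : Type*) [Field K] :
    MvPolynomial ℕ+ K →ₐ[K] MvPolynomial ℕ+ K ⊗[K] MvPolynomial ℕ+ K :=
  MvPolynomial.aeval fun n => MvPolynomial.X n ⊗ₜ[K] 1 + 1 ⊗ₜ[K] MvPolynomial.X n

theorem polyComul_X (n : ℕ+) : polyComul K (MvPolynomial.X n) =
    MvPolynomial.X n ⊗ₜ[K] 1 + 1 ⊗ₜ[K] MvPolynomial.X n :=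
  MvPolynomial.aeval_X _ _

/-- The linear map `N ⊗ 1 + 1 ⊗ N`, where `N` is the derivation `shiftDer K n`. -/
def shiftTensor (K : Type*) [Field K] (n : ℕ+) :
    MvPolynomial ℕ+ K ⊗[K] MvPolynomial ℕ+ K →ₗ[K] MvPolynomial ℕ+ K ⊗[K] MvPolynomial ℕ+ K :=
  TensorProduct.map (shiftDer K n : _ →ₗ[K] _) LinearMap.id +
    TensorProduct.map LinearMap.id (shiftDer K n : _ →ₗ[K] _)

theorem shiftTensor_tmul (n : ℕ+) (a b : MvPolynomial ℕ+ K) :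
    shiftTensor K n (a ⊗ₜ[K] b) = shiftDer K n a ⊗ₜ[K] b + a ⊗ₜ[K] shiftDer K n b :=
  rfl

theorem shiftTensor_mul (n : ℕ+) (x y : MvPolynomial ℕ+ K ⊗[K] MvPolynomial ℕ+ K) :
    shiftTensor K n (x * y) = x * shiftTensor K n y + y * shiftTensor K n x := by
  induction x with
  | zero => simp
  | add x x' hx hx' => rw [add_mul, map_add, hx, hx', map_add]; ring
  | tmul a b =>
    induction y with
    | zero => simp
    | add y y' hy hy' => rw [mul_add, map_add, hy, hy', map_add]; ring
    | tmul c d =>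
      simp only [Algebra.TensorProduct.tmul_mul_tmul, shiftTensor_tmul, Derivation.leibniz,
        smul_eq_mul, mul_add, TensorProduct.add_tmul, TensorProduct.tmul_add]
      rw [mul_comm c a, mul_comm d b]
      abel

theorem polyComul_shiftDer (n : ℕ+) (f : MvPolynomial ℕ+ K) :
    polyComul K (shiftDer K n f) = shiftTensor K n (polyComul K f) := by
  induction f using MvPolynomial.induction_on with
  | C a =>
    rw [shiftDer, MvPolynomial.derivation_C, map_zero, ← MvPolynomial.algebraMap_eq,
      AlgHom.commutes, Algebra.TensorProduct.algebraMap_apply, shiftTensor_tmul, shiftDer]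
    simp
  | add p q hp hq => rw [map_add, map_add, hp, hq, map_add, map_add]
  | mul_X p k hp =>
    rw [Derivation.leibniz, map_add, smul_eq_mul, smul_eq_mul, map_mul, map_mul, map_mul, hp,
      shiftTensor_mul, polyComul_X, map_add, shiftTensor_tmul, shiftTensor_tmul]
    simp [shiftDer, MvPolynomial.mkDerivation_X, polyComul_X]

theorem map_transition_mul (n : ℕ+) (z : MvPolynomial ℕ+ K ⊗[K] MvPolynomial ℕ+ K) :
    TensorProduct.map (transition K) (transition K) (polyComul K (MvPolynomial.X n) * z) =
      polyComul K (MvPolynomial.X n) * TensorProduct.map (transition K) (transition K) z +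
        shiftTensor K n (TensorProduct.map (transition K) (transition K) z) := by
  induction z with
  | zero => simp
  | add x y hx hy => rw [mul_add, map_add, hx, hy, map_add, map_add]; ring
  | tmul a b =>
    rw [polyComul_X, add_mul, Algebra.TensorProduct.tmul_mul_tmul,
      Algebra.TensorProduct.tmul_mul_tmul, one_mul, one_mul, map_add, TensorProduct.map_tmul,
      TensorProduct.map_tmul, TensorProduct.map_tmul, shiftTensor_tmul, transition_X_mul,
      transition_X_mul, add_mul, Algebra.TensorProduct.tmul_mul_tmul,
      Algebra.TensorProduct.tmul_mul_tmul, one_mul, one_mul, TensorProduct.add_tmul,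
      TensorProduct.tmul_add]
    abel

theorem polyComul_transition (f : MvPolynomial ℕ+ K) :
    polyComul K (transition K f) =
      TensorProduct.map (transition K) (transition K) (polyComul K f) := by
  induction f using MvPolynomial.induction_on with
  | C a =>
    rw [← MvPolynomial.algebraMap_eq, Algebra.algebraMap_eq_smul_one]
    simp [transition_one, Algebra.TensorProduct.one_def]
  | add p q hp hq => rw [map_add, map_add, hp, hq, map_add, map_add]
  | mul_X p n hp =>
    rw [mul_comm, transition_X_mul, map_add, map_mul, map_mul, polyComul_shiftDer, hp,
      map_transition_mul]

theorem comul_mtildeEquiv (f : MvPolynomial ℕ+ K) :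
    Coalgebra.comul (R := K) (mtildeEquiv K f) =
      TensorProduct.map (mtildeEquiv K).toLinearMap (mtildeEquiv K).toLinearMap
        (polyComul K f) := by
  obtain ⟨g, rfl⟩ := transition_bijective.surjective f
  have h1 : (Bialgebra.comulAlgHom K (Lambda K)).comp (psumHom K) =
      (Algebra.TensorProduct.map (psumHom K) (psumHom K)).comp (polyComul K) :=
    MvPolynomial.algHom_ext fun n => by
      simp [psumHom, polyComul_X, comul_psum]
  have h2 := DFunLike.congr_fun h1 g
  have h3 : mtildeEquiv K (transition K g) = psumHom K g := mtildeLin_transition g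
  have h4 : (mtildeEquiv K).toLinearMap ∘ₗ transition K = (psumHom K).toLinearMap :=
    LinearMap.ext mtildeLin_transition
  rw [h3, polyComul_transition, ← LinearMap.comp_apply (TensorProduct.map _ _),
    ← TensorProduct.map_comp, h4]
  exact h2

theorem counit_mtildeEquiv (f : MvPolynomial ℕ+ K) :
    Coalgebra.counit (R := K) (mtildeEquiv K f) =
      MvPolynomial.aeval (fun _ : ℕ+ => (0 : K)) f := by
  have hs : ∀ n (f : MvPolynomial ℕ+ K),
      MvPolynomial.aeval (fun _ : ℕ+ => (0 : K)) (shiftDer K n f) = 0 := by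
    intro n f
    induction f using MvPolynomial.induction_on with
    | C a => rw [shiftDer, MvPolynomial.derivation_C, map_zero]
    | add p q hp hq => rw [map_add, map_add, hp, hq, add_zero]
    | mul_X p k hp => simp [shiftDer, MvPolynomial.mkDerivation_X]
  have ht : ∀ f : MvPolynomial ℕ+ K, MvPolynomial.aeval (fun _ : ℕ+ => (0 : K))
      (transition K f) = MvPolynomial.aeval (fun _ : ℕ+ => (0 : K)) f := by
    intro f
    induction f using MvPolynomial.induction_on with
    | C a =>
      rw [← MvPolynomial.algebraMap_eq, Algebra.algebraMap_eq_smul_one]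
      simp [transition_one]
    | add p q hp hq => rw [map_add, map_add, hp, hq, map_add]
    | mul_X p n hp =>
      rw [mul_comm, transition_X_mul, map_add, hs]
      simp
  obtain ⟨g, rfl⟩ := transition_bijective.surjective f
  have h1 : (Bialgebra.counitAlgHom K (Lambda K)).comp (psumHom K) =
      MvPolynomial.aeval (fun _ : ℕ+ => (0 : K)) :=
    MvPolynomial.algHom_ext fun n => by simp [psumHom, counit_psum]
  have h3 : mtildeEquiv K (transition K g) = psumHom K g := mtildeLin_transition g
  rw [h3, ht]
  exact DFunLike.congr_fun h1 g

/-! ### The Hopf algebra `Λ̃` -/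

/-- The vector space `Λ̃`: a copy of the vector space `Λ`, to be given another product. -/
def LambdaTilde (K : Type*) [Field K] : Type _ := Lambda K

instance : AddCommGroup (LambdaTilde K) := inferInstanceAs (AddCommGroup (Lambda K))

instance : Module K (LambdaTilde K) := inferInstanceAs (Module K (Lambda K))

/-- The identity map from `Λ` to `Λ̃`, as a linear isomorphism. -/
def toTilde (K : Type*) [Field K] : Lambda K ≃ₗ[K] LambdaTilde K := LinearEquiv.refl K (Lambda K)

/-- The linear isomorphism from the polynomial algebra to `Λ̃` sending the monomial
`∏ k, X k ^ r k` to `m̃_r`. -/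
def tildeLinEquiv (K : Type*) [Field K] [CharZero K] : MvPolynomial ℕ+ K ≃ₗ[K] LambdaTilde K :=
  (mtildeEquiv K).trans (toTilde K)

/-- The product `⊙` of `Λ̃`, i.e. the bilinear product with `m̃_r ⊙ m̃_s = m̃_(r + s)`; here
`r + s` is the partition formed by all parts of `r` together with all parts of `s`. -/
instance : Mul (LambdaTilde K) :=
  ⟨fun a b => tildeLinEquiv K ((tildeLinEquiv K).symm a * (tildeLinEquiv K).symm b)⟩

instance : One (LambdaTilde K) := ⟨tildeLinEquiv K 1⟩

theorem tildeLinEquiv_mul (f g : MvPolynomial ℕ+ K) :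
    tildeLinEquiv K (f * g) = tildeLinEquiv K f * tildeLinEquiv K g := by
  change _ = tildeLinEquiv K ((tildeLinEquiv K).symm (tildeLinEquiv K f) *
    (tildeLinEquiv K).symm (tildeLinEquiv K g))
  rw [LinearEquiv.symm_apply_apply, LinearEquiv.symm_apply_apply]

theorem tildeLinEquiv_one : tildeLinEquiv K 1 = 1 := rfl

instance : CommRing (LambdaTilde K) :=
  { (inferInstance : AddCommGroup (LambdaTilde K)) with
    mul := (· * ·)
    one := 1
    left_distrib := fun a b c => by
      change a * (b + c) = a * b + a * c
      obtain ⟨a, rfl⟩ := (tildeLinEquiv K).surjective a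
      obtain ⟨b, rfl⟩ := (tildeLinEquiv K).surjective b
      obtain ⟨c, rfl⟩ := (tildeLinEquiv K).surjective c
      rw [← map_add, ← tildeLinEquiv_mul, mul_add, map_add, tildeLinEquiv_mul, tildeLinEquiv_mul]
    right_distrib := fun a b c => by
      change (a + b) * c = a * c + b * c
      obtain ⟨a, rfl⟩ := (tildeLinEquiv K).surjective a
      obtain ⟨b, rfl⟩ := (tildeLinEquiv K).surjective b
      obtain ⟨c, rfl⟩ := (tildeLinEquiv K).surjective c
      rw [← map_add, ← tildeLinEquiv_mul, add_mul, map_add, tildeLinEquiv_mul, tildeLinEquiv_mul]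
    zero_mul := fun a => by
      change 0 * a = 0
      obtain ⟨a, rfl⟩ := (tildeLinEquiv K).surjective a
      rw [← map_zero (tildeLinEquiv K), ← tildeLinEquiv_mul, zero_mul]
    mul_zero := fun a => by
      change a * 0 = 0
      obtain ⟨a, rfl⟩ := (tildeLinEquiv K).surjective a
      rw [← map_zero (tildeLinEquiv K), ← tildeLinEquiv_mul, mul_zero]
    mul_assoc := fun a b c => by
      change a * b * c = a * (b * c)
      obtain ⟨a, rfl⟩ := (tildeLinEquiv K).surjective a
      obtain ⟨b, rfl⟩ := (tildeLinEquiv K).surjective b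
      obtain ⟨c, rfl⟩ := (tildeLinEquiv K).surjective c
      simp only [← tildeLinEquiv_mul, mul_assoc]
    mul_comm := fun a b => by
      change a * b = b * a
      obtain ⟨a, rfl⟩ := (tildeLinEquiv K).surjective a
      obtain ⟨b, rfl⟩ := (tildeLinEquiv K).surjective b
      rw [← tildeLinEquiv_mul, mul_comm, tildeLinEquiv_mul]
    one_mul := fun a => by
      change 1 * a = a
      obtain ⟨a, rfl⟩ := (tildeLinEquiv K).surjective a
      rw [← tildeLinEquiv_one, ← tildeLinEquiv_mul, one_mul]
    mul_one := fun a => by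
      change a * 1 = a
      obtain ⟨a, rfl⟩ := (tildeLinEquiv K).surjective a
      rw [← tildeLinEquiv_one, ← tildeLinEquiv_mul, mul_one] }

instance : Algebra K (LambdaTilde K) :=
  Algebra.ofModule
    (fun c a b => by
      obtain ⟨a, rfl⟩ := (tildeLinEquiv K).surjective a
      obtain ⟨b, rfl⟩ := (tildeLinEquiv K).surjective b
      rw [← map_smul, ← tildeLinEquiv_mul, ← tildeLinEquiv_mul, ← map_smul, smul_mul_assoc])
    (fun c a b => by
      obtain ⟨a, rfl⟩ := (tildeLinEquiv K).surjective a
      obtain ⟨b, rfl⟩ := (tildeLinEquiv K).surjective b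
      rw [← map_smul, ← tildeLinEquiv_mul, ← tildeLinEquiv_mul, ← map_smul, mul_smul_comm])

theorem toTilde_mtilde_mul (r s : ℕ+ →₀ ℕ) :
    toTilde K (mtilde K r) * toTilde K (mtilde K s) = toTilde K (mtilde K (r + s)) := by
  have h : ∀ t, toTilde K (mtilde K t) = tildeLinEquiv K (MvPolynomial.monomial t 1) := fun t =>
    congrArg (toTilde K) (mtildeLin_monomial t).symm
  rw [h, h, h, ← tildeLinEquiv_mul, MvPolynomial.monomial_mul, mul_one]

/-- The algebra isomorphism from the polynomial algebra to `Λ̃` sending `X n` to `m̃_n`. -/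
def tildeEquiv (K : Type*) [Field K] [CharZero K] : MvPolynomial ℕ+ K ≃ₐ[K] LambdaTilde K :=
  AlgEquiv.ofLinearEquiv (tildeLinEquiv K) tildeLinEquiv_one tildeLinEquiv_mul

/-- The element `m̃_n` of `Λ̃`. -/
def mtildeT (K : Type*) [Field K] (n : ℕ+) : LambdaTilde K :=
  toTilde K (mtilde K (Finsupp.single n 1))

theorem tildeEquiv_X (n : ℕ+) : tildeEquiv K (MvPolynomial.X n) = mtildeT K n :=
  congrArg (toTilde K) (mtildeLin_monomial _)

theorem tildeEquiv_symm_mtildeT (n : ℕ+) : (tildeEquiv K).symm (mtildeT K n) = MvPolynomial.X n := by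
  rw [← tildeEquiv_X, AlgEquiv.symm_apply_apply]

theorem LambdaTilde_algHom_ext {A : Type*} [Semiring A] [Algebra K A]
    {f g : LambdaTilde K →ₐ[K] A} (h : ∀ n, f (mtildeT K n) = g (mtildeT K n)) : f = g := by
  have : f.comp (tildeEquiv K : MvPolynomial ℕ+ K →ₐ[K] LambdaTilde K) =
      g.comp (tildeEquiv K : MvPolynomial ℕ+ K →ₐ[K] LambdaTilde K) :=
    MvPolynomial.algHom_ext fun n => by simpa [tildeEquiv_X] using h n
  ext1 x
  obtain ⟨y, rfl⟩ := (tildeEquiv K).surjective x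
  exact DFunLike.congr_fun this y

/-- The coproduct of `Λ`, regarded as a linear map on `Λ̃`. -/
def tildeComul (K : Type*) [Field K] [CharZero K] :
    LambdaTilde K →ₗ[K] LambdaTilde K ⊗[K] LambdaTilde K :=
  TensorProduct.map (toTilde K).toLinearMap (toTilde K).toLinearMap ∘ₗ
    Coalgebra.comul ∘ₗ (toTilde K).symm.toLinearMap

/-- The counit of `Λ`, regarded as a linear map on `Λ̃`. -/
def tildeCounit (K : Type*) [Field K] [CharZero K] : LambdaTilde K →ₗ[K] K :=
  Coalgebra.counit ∘ₗ (toTilde K).symm.toLinearMap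

theorem tildeComul_tildeEquiv (f : MvPolynomial ℕ+ K) :
    tildeComul K (tildeEquiv K f) = Algebra.TensorProduct.map
      (tildeEquiv K : MvPolynomial ℕ+ K →ₐ[K] LambdaTilde K)
      (tildeEquiv K : MvPolynomial ℕ+ K →ₐ[K] LambdaTilde K) (polyComul K f) := by
  have h : tildeComul K (tildeEquiv K f) =
      TensorProduct.map (toTilde K).toLinearMap (toTilde K).toLinearMap
        (Coalgebra.comul (R := K) (mtildeEquiv K f)) := rfl
  rw [h, comul_mtildeEquiv, ← LinearMap.comp_apply (TensorProduct.map _ _),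
    ← TensorProduct.map_comp]
  rfl

theorem tildeCounit_tildeEquiv (f : MvPolynomial ℕ+ K) :
    tildeCounit K (tildeEquiv K f) = MvPolynomial.aeval (fun _ : ℕ+ => (0 : K)) f :=
  counit_mtildeEquiv f

/-- The coproduct of `Λ̃` is multiplicative for `⊙`. -/
def tildeComulHom (K : Type*) [Field K] [CharZero K] :
    LambdaTilde K →ₐ[K] LambdaTilde K ⊗[K] LambdaTilde K :=
  AlgHom.ofLinearMap (tildeComul K)
    (by rw [← map_one (tildeEquiv K), tildeComul_tildeEquiv, map_one, map_one])
    (fun a b => by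
      obtain ⟨a, rfl⟩ := (tildeEquiv K).surjective a
      obtain ⟨b, rfl⟩ := (tildeEquiv K).surjective b
      rw [← map_mul, tildeComul_tildeEquiv, tildeComul_tildeEquiv, tildeComul_tildeEquiv,
        map_mul, map_mul])

/-- The counit of `Λ̃` is multiplicative for `⊙`. -/
def tildeCounitHom (K : Type*) [Field K] [CharZero K] : LambdaTilde K →ₐ[K] K :=
  AlgHom.ofLinearMap (tildeCounit K)
    (by rw [← map_one (tildeEquiv K), tildeCounit_tildeEquiv, map_one])
    (fun a b => by
      obtain ⟨a, rfl⟩ := (tildeEquiv K).surjective a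
      obtain ⟨b, rfl⟩ := (tildeEquiv K).surjective b
      rw [← map_mul, tildeCounit_tildeEquiv, tildeCounit_tildeEquiv, tildeCounit_tildeEquiv,
        map_mul])

theorem tildeComulHom_mtildeT (n : ℕ+) :
    tildeComulHom K (mtildeT K n) = mtildeT K n ⊗ₜ[K] 1 + 1 ⊗ₜ[K] mtildeT K n := by
  change tildeComul K (mtildeT K n) = _
  rw [← tildeEquiv_X, tildeComul_tildeEquiv, polyComul_X]
  simp

theorem tildeCounitHom_mtildeT (n : ℕ+) : tildeCounitHom K (mtildeT K n) = 0 := by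
  change tildeCounit K (mtildeT K n) = _
  rw [← tildeEquiv_X, tildeCounit_tildeEquiv, MvPolynomial.aeval_X]

/-- The bialgebra `Λ̃`: the product is `⊙`, the coproduct and the counit are those of `Λ`. -/
instance : Bialgebra K (LambdaTilde K) :=
  Bialgebra.ofAlgHom (tildeComulHom K) (tildeCounitHom K)
    (LambdaTilde_algHom_ext fun n => by
      simp [tildeComulHom_mtildeT, Algebra.TensorProduct.one_def, TensorProduct.add_tmul,
        TensorProduct.tmul_add]
      abel)
    (LambdaTilde_algHom_ext fun n => by simp [tildeComulHom_mtildeT, tildeCounitHom_mtildeT])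
    (LambdaTilde_algHom_ext fun n => by simp [tildeComulHom_mtildeT, tildeCounitHom_mtildeT])

theorem comul_toTilde (f : Lambda K) : Coalgebra.comul (R := K) (toTilde K f) =
    TensorProduct.map (toTilde K).toLinearMap (toTilde K).toLinearMap
      (Coalgebra.comul (R := K) f) :=
  rfl

theorem counit_toTilde (f : Lambda K) :
    Coalgebra.counit (R := K) (toTilde K f) = Coalgebra.counit (R := K) f :=
  rfl

theorem comul_mtildeT (n : ℕ+) : Coalgebra.comul (R := K) (mtildeT K n) =
    mtildeT K n ⊗ₜ[K] (1 : LambdaTilde K) + (1 : LambdaTilde K) ⊗ₜ[K] mtildeT K n :=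
  tildeComulHom_mtildeT n

theorem counit_mtildeT (n : ℕ+) : Coalgebra.counit (R := K) (mtildeT K n) = 0 :=
  tildeCounitHom_mtildeT n

/-- The algebra morphism `m̃_n ↦ -m̃_n` of `Λ̃`. -/
def tildeAntipode (K : Type*) [Field K] [CharZero K] : LambdaTilde K →ₐ[K] LambdaTilde K :=
  (MvPolynomial.aeval fun n => -mtildeT K n).comp
    ((tildeEquiv K).symm : LambdaTilde K →ₐ[K] MvPolynomial ℕ+ K)

theorem tildeAntipode_mtildeT (n : ℕ+) : tildeAntipode K (mtildeT K n) = -mtildeT K n := by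
  simp [tildeAntipode, tildeEquiv_symm_mtildeT]

/-- The Hopf algebra `Λ̃`, with antipode `m̃_n ↦ -m̃_n`. -/
instance : HopfAlgebra K (LambdaTilde K) :=
  HopfAlgebra.ofAlgHom (tildeAntipode K)
    (LambdaTilde_algHom_ext fun n => by
      rw [AlgHom.comp_apply, Bialgebra.comulAlgHom_apply, comul_mtildeT, map_add]
      refine (congrArg₂ (· + ·)
        (Algebra.TensorProduct.lift_tmul _ _ (fun _ _ => Commute.all _ _) _ _)
        (Algebra.TensorProduct.lift_tmul _ _ (fun _ _ => Commute.all _ _) _ _)).trans ?_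
      simp [counit_mtildeT, tildeAntipode_mtildeT])
    (LambdaTilde_algHom_ext fun n => by
      simp [comul_mtildeT, counit_mtildeT, Algebra.TensorProduct.lift_tmul, tildeAntipode_mtildeT])

/-! ### Gradings -/

/-- The degree `n` part of `Λ`: the symmetric functions that are homogeneous of degree `n`. -/
def gradeLambda (K : Type*) [Field K] (n : ℕ) : Submodule K (Lambda K) where
  carrier := {f | ∀ d : ℕ →₀ ℕ, MvPowerSeries.coeff d (f : MvPowerSeries ℕ K) ≠ 0 → d.degree = n}
  add_mem' := fun {f g} hf hg d hd => by
    by_cases h : MvPowerSeries.coeff d (f : MvPowerSeries ℕ K) = 0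
    · refine hg d fun h' => hd ?_
      rw [AddMemClass.coe_add, map_add, h, h', add_zero]
    · exact hf d h
  zero_mem' := fun d hd => absurd (map_zero _) hd
  smul_mem' := fun c f hf d hd => by
    refine hf d fun h => hd ?_
    change MvPowerSeries.coeff d (c • (f : MvPowerSeries ℕ K)) = 0
    rw [MvPowerSeries.coeff_smul, h, mul_zero]

/-- The degree `n` part of `Λ̃`, which is the same subspace as for `Λ`. -/
def gradeTilde (K : Type*) [Field K] (n : ℕ) : Submodule K (LambdaTilde K) :=
  (gradeLambda K n).map (toTilde K).toLinearMap

/-- A morphism of graded Hopf algebras `Λ → Λ̃`: a map preserving the product, unit, coproduct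
and counit (hence also the antipode) that sends the degree `n` part into the degree `n` part. -/
def IsGraded (φ : Lambda K →ₐc[K] LambdaTilde K) : Prop :=
  ∀ (n : ℕ) (f : Lambda K), f ∈ gradeLambda K n → φ f ∈ gradeTilde K n

end SymmFun
end

open SymmFun

/-! Weighted graphs put the two products on an equal footing. The chromatic function of the edgeless
graph with weights `w` is `∏ p_(w i)` (`prod_psum`), and that of the complete graph is `m̃` of the
partition formed by the weights, i.e. the `⊙`-product of the `m̃_(w i)` (`csf_top`, `prod_mtildeT`).
Hence the map `p_n ↦ c n • m̃_n`, a bialgebra morphism for every `c` because both sides are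
primitive, replaces edgeless by complete graphs at the cost of the scalar `∏ c (w i)`
(`scaleHom_csf_bot`).

Both `X_G` and `X_Gᶜ` are sums over edge sets `S ⊆ E(G)`, with weights given by the component sizes
of `(V, S)`. Inclusion–exclusion gives `X_G = ∑ (-1)^|S| p_(λ(S))` (`csf_eq_sum`). A proper
colouring of `Gᶜ` has cliques of `G` as colour classes; if `G` is triangle-free these have at most
two vertices, so the classes are the components of a matching, and `X_Gᶜ = ∑ m̃_(λ(S))` over the
matchings `S` (`csf_compl_eq_sum`). With `c = (1, -1, 0, 0, …)` the scalar is `(-1)^|S|` for a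
matching and `0` otherwise (`prod_pairingCoeff`); the two signs cancel and the expansions match term
by term (`scaleHom_csf`).

For the grading, the morphism multiplies each `p_r` by a scalar and turns it into `m̃_r`, of the
same degree; homogeneous elements are combinations of the `p_r` of their own degree
(`gradeLambda_le_span`).

For uniqueness, trees suffice. In the expansion of `X_T` for a tree on `n` vertices, `S = E(T)`
contributes `±p_n` and every proper subset contributes a product of `p_m` with `m < n`. By induction
on `n`, the values on trees determine an algebra morphism on all `p_n`, which generate `Λ`. -/

noncomputable section

open scoped TensorProduct

namespace SymmFun

variable {K : Type*} [Field K]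

/-! ### Coefficients of chromatic symmetric functions -/

section Coefficients

theorem top_adj_imp_ne_iff {α β : Type*} (f : α → β) :
    (∀ a b, (⊤ : SimpleGraph α).Adj a b → f a ≠ f b) ↔ Function.Injective f :=
  ⟨fun h a b hab => by_contra fun hne => h a b hne hab, fun h _ _ hab hf => hab (h hf)⟩

variable {V ι : Type*} [Fintype V] [Fintype ι]

theorem finite_maps_of_weight (w : V → ℕ+) (d : ℕ →₀ ℕ) :
    {κ : V → ℕ | ∑ v, Finsupp.single (κ v) (w v : ℕ) = d}.Finite := by
  refine (Set.Finite.pi' fun _ : V => d.support.finite_toSet).subset fun κ hκ v => ?_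
  rw [Finset.mem_coe, Finsupp.mem_support_iff, ← DFunLike.congr_fun hκ, Finsupp.finsetSum_apply]
  intro h
  have := (Finset.sum_eq_zero_iff.1 h) v (Finset.mem_univ v)
  simp at this

/-- The maps `κ : V → ℕ` with `∏ v, x (κ v) ^ w v = x ^ d`. -/
def mapsOfWeight (w : V → ℕ+) (d : ℕ →₀ ℕ) : Finset (V → ℕ) :=
  (finite_maps_of_weight w d).toFinset

theorem mem_mapsOfWeight {w : V → ℕ+} {d : ℕ →₀ ℕ} {κ : V → ℕ} :
    κ ∈ mapsOfWeight w d ↔ ∑ v, Finsupp.single (κ v) (w v : ℕ) = d := by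
  simp [mapsOfWeight]

open Classical in
-- The index set depends on `w` and `d` but not on `G`; only the indicator sees the edges.
-- Identities between chromatic functions can therefore be checked one map `κ` at a time.
theorem coeff_csf (G : SimpleGraph V) (w : V → ℕ+) (d : ℕ →₀ ℕ) :
    MvPowerSeries.coeff d (csf K G w : MvPowerSeries ℕ K) =
      ∑ κ ∈ mapsOfWeight w d, if ∀ a b, G.Adj a b → κ a ≠ κ b then 1 else 0 := by
  rw [Finset.sum_boole]
  change (Nat.card {κ : G.Coloring ℕ // ∑ v, Finsupp.single (κ v) (w v : ℕ) = d} : K) = _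
  congr 1
  rw [← Nat.card_eq_finsetCard]
  refine Nat.card_congr
    ⟨fun κ => ⟨κ.1, by
        rw [Finset.mem_filter, mem_mapsOfWeight]
        exact ⟨κ.2, fun a b h => κ.1.valid h⟩⟩,
      fun κ => ⟨SimpleGraph.Coloring.mk κ.1 fun {a b} h => (Finset.mem_filter.1 κ.2).2 a b h,
        mem_mapsOfWeight.1 (Finset.mem_filter.1 κ.2).1⟩,
      fun κ => rfl, fun κ => rfl⟩

/-- The size of the fibre of a surjective map over `i`. -/
def fiberSize {q : V → ι} (hq : Function.Surjective q) (i : ι) : ℕ+ :=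
  ⟨Nat.card {v // q v = i},
    have : Nonempty {v // q v = i} := let ⟨v, hv⟩ := hq i; ⟨⟨v, hv⟩⟩
    Nat.card_pos⟩

theorem sum_fiberSize {M : Type*} [AddCommMonoid M] {q : V → ι} (hq : Function.Surjective q)
    (g : ι → M) : ∑ i, (fiberSize hq i : ℕ) • g i = ∑ v, g (q v) := by
  classical
  rw [← Finset.sum_fiberwise Finset.univ q fun v => g (q v)]
  refine Finset.sum_congr rfl fun i _ => ?_
  rw [Finset.sum_congr rfl fun v hv => by rw [(Finset.mem_filter.1 hv).2], Finset.sum_const]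
  congr 1
  change Nat.card _ = _
  rw [Nat.card_eq_fintype_card, Fintype.card_subtype]

open Classical in
-- Composing with `q` turns a colouring of the weighted quotient into a colouring of `V` with the
-- same monomial, since a colour on `i` is counted once for each vertex of the fibre. All terms of
-- an expansion thus become sums over the same unweighted maps `V → ℕ`, whatever the quotient is.
theorem coeff_csf_fiberSize (H : SimpleGraph ι) {q : V → ι} (hq : Function.Surjective q)
    (d : ℕ →₀ ℕ) :
    MvPowerSeries.coeff d (csf K H (fiberSize hq) : MvPowerSeries ℕ K) =
      ∑ κ ∈ mapsOfWeight (fun _ : V => 1) d,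
        if ∃ f : ι → ℕ, κ = f ∘ q ∧ ∀ i j, H.Adj i j → f i ≠ f j then 1 else 0 := by
  rw [coeff_csf, Finset.sum_boole, Finset.sum_boole]
  congr 1
  have hw : ∀ f : ι → ℕ, ∑ v, Finsupp.single ((f ∘ q) v) (1 : ℕ) =
      ∑ i, Finsupp.single (f i) (fiberSize hq i : ℕ) := by
    intro f
    rw [Function.comp_def, ← sum_fiberSize hq fun i => Finsupp.single (f i) (1 : ℕ)]
    simp
  refine Finset.card_bij (fun f _ => f ∘ q) ?_ ?_ ?_
  · intro f hf
    rw [Finset.mem_filter, mem_mapsOfWeight] at hf ⊢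
    exact ⟨(hw f).trans hf.1, f, rfl, hf.2⟩
  · intro f _ g _ h
    exact hq.injective_comp_right h
  · intro κ hκ
    rw [Finset.mem_filter, mem_mapsOfWeight] at hκ
    obtain ⟨hd, f, rfl, hf⟩ := hκ
    refine ⟨f, ?_, rfl⟩
    rw [Finset.mem_filter, mem_mapsOfWeight]
    exact ⟨(hw f).symm.trans hd, hf⟩

/-- Expanding the product means choosing a variable `x (κ i)` in each factor independently, and
every such choice is a proper colouring of the edgeless graph. -/
theorem prod_psum (w : ι → ℕ+) : ∏ i, psum K (w i) = csf K ⊥ w := by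
  classical
  refine Subtype.ext (MvPowerSeries.ext fun d => ?_)
  have hp : ∀ (n : ℕ+) (a : ℕ →₀ ℕ), MvPowerSeries.coeff a (psum K n : MvPowerSeries ℕ K) =
      if ∃ i : ℕ, a = Finsupp.single i (n : ℕ) then 1 else 0 := fun n a => by
    change (if ∃ i : ℕ, a = Finsupp.single i (n : ℕ) then (1 : K) else 0) = _
    rfl
  rw [SubmonoidClass.coe_finsetProd, MvPowerSeries.coeff_prod, coeff_csf]
  simp only [hp, Finset.prod_ite_zero, Finset.prod_const_one, SimpleGraph.bot_adj, false_imp_iff,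
    implies_true, if_true]
  rw [Finset.sum_boole, Finset.sum_const, nsmul_one]
  congr 1
  symm
  refine Finset.card_bij
    (fun κ _ => Finsupp.equivFunOnFinite.symm fun i => Finsupp.single (κ i) (w i : ℕ)) ?_ ?_ ?_
  · intro κ hκ
    rw [mem_mapsOfWeight] at hκ
    rw [Finset.mem_filter, Finset.mem_finsuppAntidiag]
    exact ⟨⟨hκ, Finset.subset_univ _⟩, fun i _ => ⟨κ i, rfl⟩⟩
  · intro κ _ κ' _ h
    funext i
    exact (Finsupp.single_left_inj (w i).ne_zero).1 (DFunLike.congr_fun h i)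
  · intro l hl
    rw [Finset.mem_filter, Finset.mem_finsuppAntidiag] at hl
    choose κ hκ using fun i => hl.2 i (Finset.mem_univ i)
    refine ⟨κ, ?_, ?_⟩
    · rw [mem_mapsOfWeight, ← hl.1.1]
      exact Finset.sum_congr rfl fun i _ => (hκ i).symm
    · ext1 i
      exact (hκ i).symm

/-! ### Complete graphs and augmented monomial functions. -/

theorem expType_sum_single {f : ι → ℕ} (hf : Function.Injective f) (w : ι → ℕ+) :
    expType (∑ i, Finsupp.single (f i) (w i : ℕ)) = ∑ i, Finsupp.single (w i) 1 := by
  classical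
  have : ∀ s : Finset ι, expType (∑ i ∈ s, Finsupp.single (f i) (w i : ℕ)) =
      ∑ i ∈ s, Finsupp.single (w i) 1 := by
    intro s
    induction s using Finset.induction_on with
    | empty => simp [expType]
    | insert i s hi ih =>
      have h0 : (∑ j ∈ s, Finsupp.single (f j) (w j : ℕ)) (f i) = 0 := by
        rw [Finsupp.finsetSum_apply]
        refine Finset.sum_eq_zero fun j hj => Finsupp.single_eq_of_ne fun h => hi ?_
        rwa [hf h]
      rw [Finset.sum_insert hi, Finset.sum_insert hi, ← ih,
        expType_eq_erase _ (f i) (w i) (by rw [Finsupp.add_apply, h0]; simp), add_comm]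
      congr 2
      rw [Finsupp.erase_add, Finsupp.erase_single, zero_add]
      exact Finsupp.erase_of_notMem_support (by simpa using h0)
  exact this Finset.univ

theorem sum_single_apply_of_injective {f : ι → ℕ} (hf : Function.Injective f) (w : ι → ℕ+)
    (i : ι) : (∑ j, Finsupp.single (f j) (w j : ℕ)) (f i) = w i := by
  rw [Finsupp.finsetSum_apply, Finset.sum_eq_single i]
  · simp
  · intro j _ hj
    exact Finsupp.single_eq_of_ne fun h => hj (hf h).symm
  · simp

theorem mem_range_of_sum_single_ne_zero {f : ι → ℕ} {w : ι → ℕ+} {c : ℕ}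
    (h : (∑ j, Finsupp.single (f j) (w j : ℕ)) c ≠ 0) : ∃ i, f i = c := by
  rw [Finsupp.finsetSum_apply] at h
  obtain ⟨i, -, hi⟩ := Finset.exists_ne_zero_of_sum_ne_zero h
  refine ⟨i, ?_⟩
  by_contra hne
  exact hi (Finsupp.single_eq_of_ne (Ne.symm hne))

/-- A permutation preserves `w` exactly when it permutes each fibre of `w`, and the fibre over `k`
has as many elements as the partition has parts equal to `k`. -/
theorem factProd_sum_single (w : ι → ℕ+) :
    factProd (∑ i, Finsupp.single (w i) 1) = Nat.card {σ : Equiv.Perm ι // w ∘ σ = w} := by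
  classical
  have h : ∀ k, (∑ i, Finsupp.single (w i) 1 : ℕ+ →₀ ℕ) k = Fintype.card {i // w i = k} := by
    intro k
    rw [Finsupp.finsetSum_apply, Fintype.card_subtype, Finset.card_filter]
    exact Finset.sum_congr rfl fun i _ => Finsupp.single_apply
  rw [Nat.card_eq_fintype_card, DomMulAct.stabilizer_card', factProd,
    Finsupp.prod_of_support_subset _ (s := Finset.univ.image w)]
  · exact Finset.prod_congr rfl fun k _ => by rw [h]
  · intro k hk
    rw [Finsupp.mem_support_iff, h, ← Nat.pos_iff_ne_zero, Fintype.card_pos_iff] at hk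
    obtain ⟨i, rfl⟩ := hk
    simp
  · simp

/-- Proper colourings of a complete graph are injective, so no exponents merge and the monomial has
the weights as its exponents. The factorials in `m̃` count the colourings that give the same
monomial. -/
theorem csf_top (w : ι → ℕ+) : csf K ⊤ w = mtilde K (∑ i, Finsupp.single (w i) 1) := by
  classical
  refine Subtype.ext (MvPowerSeries.ext fun d => ?_)
  simp_rw [coeff_mtilde, coeff_csf, top_adj_imp_ne_iff]
  rw [Finset.sum_boole]
  split_ifs with hd
  · congr 1
    obtain ⟨f, hf⟩ : ∃ f : ι → ℕ, Function.Injective f :=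
      ⟨fun i => Fintype.equivFin ι i, Fin.val_injective.comp (Equiv.injective _)⟩
    obtain ⟨τ, hτ⟩ := exists_perm_of_expType_eq ((expType_sum_single hf w).trans hd.symm)
    obtain ⟨g, hg, hgd⟩ : ∃ g : ι → ℕ, Function.Injective g ∧
        ∑ i, Finsupp.single (g i) (w i : ℕ) = d := by
      refine ⟨τ ∘ f, τ.injective.comp hf, ?_⟩
      rw [← hτ, Finsupp.mapDomain_finsetSum]
      simp
    rw [factProd_sum_single, ← Nat.card_eq_finsetCard]
    symm
    -- The permutations preserving `w` act simply transitively on the injective colourings with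
    -- monomial `d`; `g` is the base point.
    refine Nat.card_eq_of_bijective (fun σ => ⟨g ∘ σ.1, ?_⟩) ⟨?_, ?_⟩
    · rw [Finset.mem_filter, mem_mapsOfWeight]
      refine ⟨?_, hg.comp σ.1.injective⟩
      rw [← hgd, ← Equiv.sum_comp σ.1 fun i => Finsupp.single (g i) (w i : ℕ)]
      exact Finset.sum_congr rfl fun i _ => by
        rw [Function.comp_apply, ← congrFun σ.2 i, Function.comp_apply]
    · intro σ σ' h
      exact Subtype.ext (Equiv.ext fun i => hg (congrFun (congrArg Subtype.val h) i))
    · rintro ⟨κ, hκ⟩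
      rw [Finset.mem_filter, mem_mapsOfWeight] at hκ
      obtain ⟨hκd, hκ⟩ := hκ
      have hex : ∀ i, ∃ j, g j = κ i := fun i => mem_range_of_sum_single_ne_zero (w := w) (by
        rw [hgd, ← hκd, sum_single_apply_of_injective hκ]
        exact (w i).ne_zero)
      choose s hs using hex
      have hs' : Function.Injective s := fun i j hij => hκ (by rw [← hs, ← hs, hij])
      refine ⟨⟨Equiv.ofBijective s (Finite.injective_iff_bijective.1 hs'), ?_⟩, ?_⟩
      -- The exponent in `d` of the colour `κ i = g (s i)` is `w i` when read off `κ` and `w (s i)`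
      -- when read off `g`.
      · funext i
        apply PNat.coe_injective
        rw [← sum_single_apply_of_injective hκ w, hκd, ← hs, ← hgd,
          sum_single_apply_of_injective hg]
        rfl
      · exact Subtype.ext (funext hs)
  · rw [Finset.filter_eq_empty_iff.2, Finset.card_empty, Nat.cast_zero]
    intro κ hκ h
    rw [mem_mapsOfWeight] at hκ
    exact hd (by rw [← hκ, expType_sum_single h])

theorem prod_mtildeT [CharZero K] (w : ι → ℕ+) :
    ∏ i, mtildeT K (w i) = toTilde K (csf K ⊤ w) := by
  classical
  have : ∀ s : Finset ι, ∏ i ∈ s, mtildeT K (w i) =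
      toTilde K (mtilde K (∑ i ∈ s, Finsupp.single (w i) 1)) := by
    intro s
    induction s using Finset.induction_on with
    | empty =>
      rw [Finset.prod_empty, Finset.sum_empty, ← tildeLinEquiv_one]
      exact congrArg (toTilde K) (mtildeLin_monomial 0)
    | insert i s hi ih =>
      rw [Finset.prod_insert hi, Finset.sum_insert hi, ih, mtildeT, toTilde_mtilde_mul]
  rw [csf_top]
  exact this Finset.univ

end Coefficients

/-! ### Connected components -/

section Components

variable {V : Type*}

instance [Finite V] (H : SimpleGraph V) : Fintype H.ConnectedComponent := Fintype.ofFinite _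

theorem connectedComponentMk_surjective (H : SimpleGraph V) :
    Function.Surjective H.connectedComponentMk :=
  Quot.mk_surjective

/-- The number of vertices of a connected component. -/
def compSize [Fintype V] (H : SimpleGraph V) : H.ConnectedComponent → ℕ+ :=
  fiberSize (connectedComponentMk_surjective H)

theorem compSize_mk [Fintype V] (H : SimpleGraph V) (a : V) :
    (compSize H (H.connectedComponentMk a) : ℕ) = Nat.card {b // H.Reachable b a} :=
  Nat.card_congr (Equiv.subtypeEquivRight fun _ => SimpleGraph.ConnectedComponent.eq)

/-- This is the condition of `coeff_csf_fiberSize` for the edgeless graph on the components; the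
next lemma treats the complete graph. -/
theorem exists_comp_connectedComponentMk {α : Type*} (H : SimpleGraph V) (κ : V → α) :
    (∃ f : H.ConnectedComponent → α, κ = f ∘ H.connectedComponentMk) ↔
      ∀ a b, H.Adj a b → κ a = κ b := by
  constructor
  · rintro ⟨f, rfl⟩ a b hab
    exact congrArg f (SimpleGraph.ConnectedComponent.eq.2 hab.reachable)
  · intro h
    refine ⟨SimpleGraph.ConnectedComponent.lift κ fun a b p _ => ?_, rfl⟩
    induction p with
    | nil => rfl
    | cons hab p ih => exact (h _ _ hab).trans (ih (by simp_all))

theorem exists_injective_comp_connectedComponentMk {α : Type*} (H : SimpleGraph V) (κ : V → α) :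
    (∃ f : H.ConnectedComponent → α, κ = f ∘ H.connectedComponentMk ∧ Function.Injective f) ↔
      ∀ a b, κ a = κ b ↔ H.Reachable a b := by
  constructor
  · rintro ⟨f, rfl, hf⟩ a b
    exact hf.eq_iff.trans SimpleGraph.ConnectedComponent.eq
  · intro h
    obtain ⟨f, rfl⟩ := (exists_comp_connectedComponentMk H κ).2
      fun a b hab => (h a b).2 hab.reachable
    refine ⟨f, rfl, fun x y hxy => ?_⟩
    obtain ⟨a, rfl⟩ := Quot.mk_surjective x
    obtain ⟨b, rfl⟩ := Quot.mk_surjective y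
    exact SimpleGraph.ConnectedComponent.eq.2 ((h a b).1 hxy)

/-- All connected components have at most two vertices. -/
def IsPairing (H : SimpleGraph V) : Prop :=
  ∀ a b c, H.Reachable a b → H.Reachable a c → a = b ∨ a = c ∨ b = c

/-- The form with three vertices meets triangle-freeness; the form with sizes meets the product of
coefficients over the components. -/
theorem isPairing_iff [Fintype V] (H : SimpleGraph V) : IsPairing H ↔ ∀ C, compSize H C ≤ 2 := by
  classical
  constructor
  · intro h C
    obtain ⟨a, rfl⟩ := Quot.mk_surjective C
    rw [← PNat.coe_le_coe]
    change (compSize H (H.connectedComponentMk a) : ℕ) ≤ 2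
    rw [compSize_mk, Nat.card_eq_fintype_card]
    by_contra! hlt
    obtain ⟨⟨x, hx⟩, ⟨y, hy⟩, ⟨z, hz⟩, hxy, hxz, hyz⟩ := Fintype.two_lt_card_iff.1 hlt
    simp only [ne_eq, Subtype.mk.injEq] at hxy hxz hyz
    rcases h x y z (hx.trans hy.symm) (hx.trans hz.symm) with h | h | h <;> contradiction
  · intro h a b c hab hac
    by_contra! hne
    have h2 := PNat.coe_le_coe _ _ |>.2 (h (H.connectedComponentMk a))
    rw [compSize_mk, Nat.card_eq_fintype_card] at h2
    exact absurd h2 (not_le.2 (Fintype.two_lt_card_iff.2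
      ⟨⟨a, .refl a⟩, ⟨b, hab.symm⟩, ⟨c, hac.symm⟩, by simpa using hne⟩))

theorem IsPairing.adj {H : SimpleGraph V} (h : IsPairing H) {a b : V} (hab : H.Reachable a b)
    (hne : a ≠ b) : H.Adj a b := by
  obtain ⟨p⟩ := hab
  cases p with
  | nil => exact absurd rfl hne
  | @cons _ x _ hax p =>
    -- The first vertex `x` after `a` on a walk to `b` lies in their component, so it can only be
    -- `b`.
    rcases h a x b hax.reachable (hax.reachable.trans ⟨p⟩) with h | h | h
    · exact absurd h hax.ne
    · exact absurd h hne
    · exact h ▸ hax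

open Classical in
-- Double counting of the sum of the squared component sizes. Summed over vertices, each component
-- being a vertex and its neighbours, it is `∑ (deg a + 1) = 2|E| + |V|`. Summed over components, as
-- `s² = s + 2·[s = 2]` for `s ∈ {1, 2}`, it is `|V|` plus twice the number of components of size
-- two.
theorem IsPairing.card_edgeFinset [Fintype V] {H : SimpleGraph V} (h : IsPairing H) :
    H.edgeFinset.card = (Finset.univ.filter fun C => compSize H C = 2).card := by
  have hdeg : ∀ a, (compSize H (H.connectedComponentMk a) : ℕ) = H.degree a + 1 := by
    intro a
    rw [compSize_mk, Nat.card_eq_fintype_card, Fintype.card_subtype,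
      ← SimpleGraph.card_neighborFinset_eq_degree,
      ← Finset.card_insert_of_notMem (H.notMem_neighborFinset_self a)]
    congr 1
    ext b
    simp only [Finset.mem_filter_univ, Finset.mem_insert, SimpleGraph.mem_neighborFinset]
    constructor
    · intro hb
      by_cases hba : b = a
      · exact Or.inl hba
      · exact Or.inr (h.adj hb hba).symm
    · rintro (rfl | hb)
      · rfl
      · exact hb.reachable.symm
  have h1 := sum_fiberSize (connectedComponentMk_surjective H)
    fun C => (compSize H C : ℕ)
  have h2 := sum_fiberSize (connectedComponentMk_surjective H) fun _ => 1
  have h3 : ∑ C, (compSize H C : ℕ) • (compSize H C : ℕ) =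
      ∑ C, ((compSize H C : ℕ) • 1 + 2 * if compSize H C = 2 then 1 else 0) := by
    refine Finset.sum_congr rfl fun C _ => ?_
    have hC := (isPairing_iff H).1 h C
    rcases hC.lt_or_eq with hlt | heq
    · have : compSize H C = 1 := PNat.lt_add_one_iff.1 hlt |> le_antisymm <| one_le
      simp [this]
    · simp [heq]
  rw [Finset.sum_add_distrib, ← Finset.mul_sum, ← Finset.card_filter] at h3
  simp_rw [hdeg] at h1
  rw [Finset.sum_add_distrib, H.sum_degrees_eq_twice_card_edges] at h1
  have h4 := h1.symm.trans (h3.trans (congrArg (· + _) h2))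
  omega

end Components

/-! ### Expansions of chromatic symmetric functions -/

section Expansion

open Classical

variable {V : Type*} [Fintype V] (G : SimpleGraph V)

theorem edgeFinset_fromEdgeSet {S : Finset (Sym2 V)} (hS : S ⊆ G.edgeFinset) :
    (SimpleGraph.fromEdgeSet (S : Set (Sym2 V))).edgeFinset = S := by
  ext e
  rw [SimpleGraph.mem_edgeFinset, SimpleGraph.edgeSet_fromEdgeSet]
  refine ⟨fun h => h.1, fun h => ⟨h, ?_⟩⟩
  exact G.not_isDiag_of_mem_edgeFinset (hS h)

theorem fromEdgeSet_adj_of_subset {S : Finset (Sym2 V)} (hS : S ⊆ G.edgeFinset) {a b : V} :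
    (SimpleGraph.fromEdgeSet (S : Set (Sym2 V))).Adj a b ↔ s(a, b) ∈ S := by
  rw [SimpleGraph.fromEdgeSet_adj]
  exact ⟨fun h => h.1, fun h => ⟨h, (SimpleGraph.mem_edgeFinset.1 (hS h)).ne⟩⟩

/-- The edges of `G` whose ends have the same colour. -/
def monoEdges (κ : V → ℕ) : Finset (Sym2 V) :=
  G.edgeFinset.filter fun e => (e.map κ).IsDiag

variable {G}

theorem monoEdges_subset (κ : V → ℕ) : monoEdges G κ ⊆ G.edgeFinset :=
  Finset.filter_subset _ _

theorem mk_mem_monoEdges {κ : V → ℕ} {a b : V} :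
    s(a, b) ∈ monoEdges G κ ↔ G.Adj a b ∧ κ a = κ b := by
  simp [monoEdges]

theorem subset_monoEdges_iff {S : Finset (Sym2 V)} (hS : S ⊆ G.edgeFinset) (κ : V → ℕ) :
    S ⊆ monoEdges G κ ↔
      ∀ a b, (SimpleGraph.fromEdgeSet (S : Set (Sym2 V))).Adj a b → κ a = κ b := by
  simp only [fromEdgeSet_adj_of_subset G hS]
  constructor
  · exact fun h a b hab => (mk_mem_monoEdges.1 (h hab)).2
  · intro h e he
    induction e with
    | h a b => exact mk_mem_monoEdges.2 ⟨SimpleGraph.mem_edgeFinset.1 (hS he), h a b he⟩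

theorem monoEdges_eq_empty_iff (κ : V → ℕ) :
    monoEdges G κ = ∅ ↔ ∀ a b, G.Adj a b → κ a ≠ κ b := by
  rw [Finset.eq_empty_iff_forall_notMem, Sym2.forall]
  simp only [mk_mem_monoEdges, not_and]

/-- The expansion of `X_G` in products of power sums. -/
theorem csf_eq_sum (G : SimpleGraph V) : csf K G (fun _ => 1) =
    ∑ S ∈ G.edgeFinset.powerset, (-1 : K) ^ S.card •
      csf K ⊥ (compSize (SimpleGraph.fromEdgeSet (S : Set (Sym2 V)))) := by
  refine Subtype.ext (MvPowerSeries.ext fun d => ?_)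
  rw [AddSubmonoidClass.coe_finsetSum, map_sum]
  have h : ∀ S ∈ G.edgeFinset.powerset, MvPowerSeries.coeff d (((-1 : K) ^ S.card •
      csf K ⊥ (compSize (SimpleGraph.fromEdgeSet (S : Set (Sym2 V)))) : Lambda K) :
        MvPowerSeries ℕ K) = ∑ κ ∈ mapsOfWeight (fun _ : V => 1) d,
          if S ⊆ monoEdges G κ then (-1 : K) ^ S.card else 0 := by
    intro S hS
    rw [Finset.mem_powerset] at hS
    rw [SetLike.val_smul, MvPowerSeries.coeff_smul, compSize, coeff_csf_fiberSize, Finset.mul_sum]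
    refine Finset.sum_congr rfl fun κ _ => ?_
    simp only [SimpleGraph.bot_adj, false_imp_iff, implies_true, and_true,
      exists_comp_connectedComponentMk, subset_monoEdges_iff hS, mul_ite, mul_one, mul_zero]
  rw [Finset.sum_congr rfl h, Finset.sum_comm, coeff_csf]
  refine Finset.sum_congr rfl fun κ _ => ?_
  rw [← Finset.sum_filter]
  have hB : G.edgeFinset.powerset.filter (· ⊆ monoEdges G κ) = (monoEdges G κ).powerset := by
    ext S
    rw [Finset.mem_filter, Finset.mem_powerset, Finset.mem_powerset]
    exact ⟨fun h => h.2, fun h => ⟨h.trans (Finset.filter_subset _ _), h⟩⟩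
  have := congrArg (Int.cast (R := K))
    (Finset.sum_powerset_neg_one_pow_card (x := monoEdges G κ))
  push_cast at this
  rw [hB, this]
  exact if_congr (monoEdges_eq_empty_iff κ).symm rfl rfl

/-- If `κ` is proper on `Gᶜ`, distinct vertices of one colour are adjacent in `G`; three of them
would be a triangle, so the monochromatic edges form a matching whose components are the colour
classes. Conversely, if the colour classes are components with at most two vertices, two vertices of
one colour are joined by an edge of `S`, hence of `G`. -/
theorem isPairing_and_reachable_iff (hG : G.CliqueFree 3) {S : Finset (Sym2 V)}
    (hS : S ⊆ G.edgeFinset) (κ : V → ℕ) :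
    (IsPairing (SimpleGraph.fromEdgeSet (S : Set (Sym2 V))) ∧
      ∀ a b, κ a = κ b ↔ (SimpleGraph.fromEdgeSet (S : Set (Sym2 V))).Reachable a b) ↔
    S = monoEdges G κ ∧ ∀ a b, Gᶜ.Adj a b → κ a ≠ κ b := by
  have hadj {a b : V} := fromEdgeSet_adj_of_subset G hS (a := a) (b := b)
  constructor
  · rintro ⟨hp, hr⟩
    refine ⟨Finset.Subset.antisymm ((subset_monoEdges_iff hS κ).2
      fun a b hab => (hr a b).2 hab.reachable) fun e he => ?_, fun a b hab hκ => ?_⟩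
    · induction e with
      | h a b =>
        obtain ⟨hab, hκ⟩ := mk_mem_monoEdges.1 he
        exact hadj.1 (hp.adj ((hr a b).1 hκ) hab.ne)
    · have := hadj.1 (hp.adj ((hr a b).1 hκ) hab.ne)
      exact ((SimpleGraph.compl_adj _ _ _).1 hab).2 (SimpleGraph.mem_edgeFinset.1 (hS this))
  · rintro ⟨rfl, hκ⟩
    have hr : ∀ a b, (SimpleGraph.fromEdgeSet (monoEdges G κ : Set (Sym2 V))).Reachable a b →
        κ a = κ b := by
      obtain ⟨f, hf⟩ := (exists_comp_connectedComponentMk _ κ).2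
        ((subset_monoEdges_iff hS κ).1 Finset.Subset.rfl)
      intro a b hab
      rw [hf]
      exact congrArg f (SimpleGraph.ConnectedComponent.eq.2 hab)
    have hG' : ∀ a b, κ a = κ b → a ≠ b → G.Adj a b := fun a b h hne =>
      by_contra fun hab => hκ a b ((SimpleGraph.compl_adj _ _ _).2 ⟨hne, hab⟩) h
    refine ⟨fun a b c hab hac => ?_, fun a b => ⟨fun h => ?_, hr a b⟩⟩
    · by_contra! hne
      have hb := hr a b hab
      have hc := hr a c hac
      exact hG {a, b, c} (SimpleGraph.is3Clique_triple_iff.2 ⟨hG' a b hb hne.1,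
        hG' a c hc hne.2.1, hG' b c (hb.symm.trans hc) hne.2.2⟩)
    · by_cases hab : a = b
      · exact hab ▸ .refl a
      · exact (hadj.2 (mk_mem_monoEdges.2 ⟨hG' a b h hab, h⟩)).reachable

/-- The expansion of `X_Gᶜ` for triangle-free `G` in augmented monomial symmetric functions. -/
theorem csf_compl_eq_sum (hG : G.CliqueFree 3) : csf K Gᶜ (fun _ => 1) =
    ∑ S ∈ G.edgeFinset.powerset,
      (if IsPairing (SimpleGraph.fromEdgeSet (S : Set (Sym2 V))) then (1 : K) else 0) •
        csf K ⊤ (compSize (SimpleGraph.fromEdgeSet (S : Set (Sym2 V)))) := by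
  refine Subtype.ext (MvPowerSeries.ext fun d => ?_)
  rw [AddSubmonoidClass.coe_finsetSum, map_sum]
  have h : ∀ S ∈ G.edgeFinset.powerset, MvPowerSeries.coeff d
      (((if IsPairing (SimpleGraph.fromEdgeSet (S : Set (Sym2 V))) then (1 : K) else 0) •
        csf K ⊤ (compSize (SimpleGraph.fromEdgeSet (S : Set (Sym2 V)))) : Lambda K) :
        MvPowerSeries ℕ K) = ∑ κ ∈ mapsOfWeight (fun _ : V => 1) d,
          if S = monoEdges G κ then
            (if ∀ a b, Gᶜ.Adj a b → κ a ≠ κ b then (1 : K) else 0) else 0 := by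
    intro S hS
    rw [Finset.mem_powerset] at hS
    rw [SetLike.val_smul, MvPowerSeries.coeff_smul, compSize, coeff_csf_fiberSize, Finset.mul_sum]
    refine Finset.sum_congr rfl fun κ _ => ?_
    simp only [top_adj_imp_ne_iff, exists_injective_comp_connectedComponentMk]
    rw [← ite_and, ← if_congr (isPairing_and_reachable_iff hG hS κ) rfl rfl, ite_and, ite_mul,
      one_mul, zero_mul]
  rw [Finset.sum_congr rfl h, Finset.sum_comm, coeff_csf]
  refine Finset.sum_congr rfl fun κ _ => ?_
  -- A given `κ` meets only one edge set, that of its monochromatic edges.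
  rw [Finset.sum_ite_eq', if_pos (Finset.mem_powerset.2 (monoEdges_subset κ))]
  congr

end Expansion

/-! ### Homogeneous elements of `Λ` -/

theorem mtilde_mem_gradeLambda (r : ℕ+ →₀ ℕ) : mtilde K r ∈ gradeLambda K (size r) := by
  intro d hd
  rw [coeff_mtilde] at hd
  by_cases h : expType d = r
  · rw [← size_expType, h]
  · simp [h] at hd

theorem mul_mem_gradeLambda {m n : ℕ} {f g : Lambda K} (hf : f ∈ gradeLambda K m)
    (hg : g ∈ gradeLambda K n) : f * g ∈ gradeLambda K (m + n) := by
  intro d hd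
  rw [MulMemClass.coe_mul, MvPowerSeries.coeff_mul] at hd
  obtain ⟨⟨a, b⟩, hab, hne⟩ := Finset.exists_ne_zero_of_sum_ne_zero hd
  rw [← Finset.HasAntidiagonal.mem_antidiagonal.1 hab, map_add,
    hf a (left_ne_zero_of_mul hne), hg b (right_ne_zero_of_mul hne)]

/-! ### The morphism `Λ → Λ̃` -/

/-- The coefficients `1, -1, 0, 0, …` of `m̃_n` in the images of the `p_n`. -/
def pairingCoeff (K : Type*) [Field K] (n : ℕ+) : K :=
  if n = 1 then 1 else if n = 2 then -1 else 0

/-- One component with at least three vertices makes the product vanish. Otherwise the factors `-1`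
come from the components of size two, which are as many as the edges. -/
theorem prod_pairingCoeff {V : Type*} [Fintype V] (H : SimpleGraph V) [Fintype H.edgeSet]
    [Decidable (IsPairing H)] :
    ∏ C, pairingCoeff K (compSize H C) =
      if IsPairing H then (-1) ^ H.edgeFinset.card else 0 := by
  classical
  split_ifs with h
  · have h2 : ∀ C, pairingCoeff K (compSize H C) = if compSize H C = 2 then -1 else 1 := by
      intro C
      rcases ((isPairing_iff H).1 h C).lt_or_eq with hlt | heq
      · have : compSize H C = 1 := le_antisymm (PNat.lt_add_one_iff.1 hlt) one_le
        simp [pairingCoeff, this]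
      · simp [pairingCoeff, heq]
    have hcard := h.card_edgeFinset
    rw [Finset.prod_congr rfl fun C _ => h2 C, ← Finset.prod_filter, Finset.prod_const,
      ← hcard]
    congr!
  · rw [isPairing_iff] at h
    push Not at h
    obtain ⟨C, hC⟩ := h
    refine Finset.prod_eq_zero (Finset.mem_univ C) ?_
    rw [pairingCoeff, if_neg (fun h1 => ?_), if_neg hC.ne']
    rw [h1] at hC
    exact absurd hC (by decide)

variable [CharZero K]

/-- The algebra morphism `Λ → Λ̃` sending `p_n` to `c n • m̃_n`. -/
def scaleAlgHom (c : ℕ+ → K) : Lambda K →ₐ[K] LambdaTilde K :=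
  liftPsum fun n => c n • mtildeT K n

theorem scaleAlgHom_psum (c : ℕ+ → K) (n : ℕ+) :
    scaleAlgHom c (psum K n) = c n • mtildeT K n :=
  liftPsum_psum _ n

/-- The bialgebra morphism `Λ → Λ̃` sending `p_n` to `c n • m̃_n`. -/
def scaleHom (c : ℕ+ → K) : Lambda K →ₐc[K] LambdaTilde K :=
  BialgHom.ofAlgHom (scaleAlgHom c)
    (Lambda_algHom_ext fun n => by
      simp [scaleAlgHom_psum, counit_psum, counit_mtildeT])
    (Lambda_algHom_ext fun n => by
      simp [scaleAlgHom_psum, comul_psum, comul_mtildeT, TensorProduct.smul_tmul',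
        TensorProduct.tmul_smul])

theorem scaleHom_psum (c : ℕ+ → K) (n : ℕ+) : scaleHom c (psum K n) = c n • mtildeT K n :=
  scaleAlgHom_psum c n

theorem scaleHom_csf_bot {ι : Type*} [Fintype ι] (c : ℕ+ → K) (w : ι → ℕ+) :
    scaleHom c (csf K ⊥ w) = (∏ i, c (w i)) • toTilde K (csf K ⊤ w) := by
  rw [← prod_psum, map_prod, ← prod_mtildeT, ← Finset.prod_smul]
  exact Finset.prod_congr rfl fun i _ => scaleHom_psum c (w i)

theorem scaleHom_csf {V : Type*} [Fintype V] {G : SimpleGraph V} (hG : G.CliqueFree 3) :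
    scaleHom (pairingCoeff K) (csf K G fun _ => 1) = toTilde K (csf K Gᶜ fun _ => 1) := by
  classical
  rw [csf_eq_sum, csf_compl_eq_sum hG, map_sum, map_sum]
  refine Finset.sum_congr rfl fun S hS => ?_
  rw [map_smul, map_smul, scaleHom_csf_bot, prod_pairingCoeff, smul_smul]
  congr 1
  rw [mul_ite, mul_zero]
  refine if_congr Iff.rfl ?_ rfl
  -- One sign comes from inclusion–exclusion and one from the coefficients. The exponents agree
  -- because `S`, a set of edges of `G`, has no diagonal pairs for `SimpleGraph.fromEdgeSet` to
  -- discard.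
  rw [← pow_add]
  refine Even.neg_one_pow ?_
  have := edgeFinset_fromEdgeSet G (Finset.mem_powerset.1 hS)
  convert Even.add_self S.card

/-! ### Compatibility with the gradings -/

theorem size_add (r s : ℕ+ →₀ ℕ) : size (r + s) = size r + size s :=
  Finsupp.sum_add_index' (by simp) (by intros; ring)

theorem psumHom_monomial_mem (r : ℕ+ →₀ ℕ) :
    psumHom K (MvPolynomial.monomial r 1) ∈ gradeLambda K (size r) := by
  induction hd : r.degree generalizing r with
  | zero =>
    rw [Finsupp.degree_eq_zero_iff] at hd
    subst hd
    rw [MvPolynomial.monomial_zero', map_one, map_one, ← mtilde_zero]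
    exact mtilde_mem_gradeLambda 0
  | succ k ih =>
    obtain ⟨n, hn⟩ : ∃ n, r n ≠ 0 := by
      by_contra! h
      have : r = 0 := Finsupp.ext h
      simp [this] at hd
    obtain ⟨t, rfl⟩ :=
      exists_add_of_le (Finsupp.single_le_iff.2 (Nat.one_le_iff_ne_zero.2 hn))
    have hm : MvPolynomial.monomial (Finsupp.single n 1 + t) (1 : K) =
        MvPolynomial.X n * MvPolynomial.monomial t 1 := by
      simp [MvPolynomial.X, MvPolynomial.monomial_mul]
    rw [hm, map_mul, size_add]
    refine mul_mem_gradeLambda ?_ (ih t ?_)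
    · rw [psumHom, MvPolynomial.aeval_X, psum_eq_mtilde]
      exact mtilde_mem_gradeLambda _
    · simp only [map_add, Finsupp.degree_single] at hd
      omega

/-- Expand `f` in the products of power sums and keep only the terms of degree `n`. The truncated
sum has the same coefficients as `f`: in degree `n` the dropped terms contribute nothing, and in
other degrees both sides vanish. -/
theorem gradeLambda_le_span (n : ℕ) : gradeLambda K n ≤ Submodule.span K
    {f | ∃ r : ℕ+ →₀ ℕ, size r = n ∧ f = psumHom K (MvPolynomial.monomial r 1)} := by
  classical
  intro f hf
  obtain ⟨g, rfl⟩ := psumHom_bijective.surjective f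
  let p : (ℕ+ →₀ ℕ) → Lambda K := fun r => g.coeff r • psumHom K (MvPolynomial.monomial r 1)
  have hp : ∀ r, p r ∈ gradeLambda K (size r) := fun r =>
    Submodule.smul_mem _ _ (psumHom_monomial_mem r)
  have hg : psumHom K g = ∑ r ∈ g.support, p r := by
    conv_lhs => rw [g.as_sum, map_sum]
    refine Finset.sum_congr rfl fun r _ => ?_
    change _ = g.coeff r • _
    rw [← map_smul, MvPolynomial.smul_monomial, smul_eq_mul, mul_one]
  have hcoe : ∀ (s : Finset (ℕ+ →₀ ℕ)) (d : ℕ →₀ ℕ),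
      MvPowerSeries.coeff d ((∑ r ∈ s, p r : Lambda K) : MvPowerSeries ℕ K) =
        ∑ r ∈ s, MvPowerSeries.coeff d (p r : MvPowerSeries ℕ K) := fun s d => by
    rw [AddSubmonoidClass.coe_finsetSum, map_sum]
  have heq : psumHom K g = ∑ r ∈ g.support.filter (size · = n), p r := by
    refine Subtype.ext (MvPowerSeries.ext fun d => ?_)
    by_cases hd : d.degree = n
    · rw [hg, hcoe, hcoe, Finset.sum_filter]
      refine Finset.sum_congr rfl fun r _ => ?_
      split_ifs with hr
      · rfl
      · by_contra hne
        exact hr ((hp r d hne).symm.trans hd)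
    · rw [by_contra fun hne => hd (hf d hne), hcoe]
      refine (Finset.sum_eq_zero fun r hr => ?_).symm
      by_contra hne
      exact hd ((hp r d hne).trans (Finset.mem_filter.1 hr).2)
  rw [heq]
  exact Submodule.sum_mem _ fun r hr => Submodule.smul_mem _ _
    (Submodule.subset_span ⟨r, (Finset.mem_filter.1 hr).2, rfl⟩)

theorem scaleHom_psumHom_monomial (c : ℕ+ → K) (r : ℕ+ →₀ ℕ) :
    scaleHom c (psumHom K (MvPolynomial.monomial r 1)) =
      (r.prod fun k m => c k ^ m) • toTilde K (mtilde K r) := by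
  have h : toTilde K (mtilde K r) = tildeEquiv K (MvPolynomial.monomial r 1) :=
    congrArg (toTilde K) (mtildeLin_monomial r).symm
  have hm : MvPolynomial.monomial r (1 : K) = r.prod fun k m => MvPolynomial.X k ^ m := by
    rw [MvPolynomial.monomial_eq, map_one, one_mul]
  rw [h, hm, Finsupp.prod, Finsupp.prod, map_prod, map_prod, map_prod,
    ← Finset.prod_smul]
  refine Finset.prod_congr rfl fun k _ => ?_
  rw [map_pow, map_pow, map_pow, tildeEquiv_X, psumHom, MvPolynomial.aeval_X, scaleHom_psum,
    smul_pow]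

theorem isGraded_scaleHom (c : ℕ+ → K) : IsGraded (scaleHom c) := by
  intro n f hf
  have : gradeLambda K n ≤ (gradeTilde K n).comap (scaleHom c : Lambda K →ₗ[K] LambdaTilde K) := by
    refine (gradeLambda_le_span n).trans (Submodule.span_le.2 ?_)
    rintro _ ⟨r, rfl, rfl⟩
    change scaleHom c _ ∈ gradeTilde K (size r)
    rw [scaleHom_psumHom_monomial]
    exact Submodule.smul_mem _ _ (Submodule.mem_map_of_mem (mtilde_mem_gradeLambda r))
  exact this hf

/-! ### Uniqueness -/

theorem compSize_lt_of_not_connected {V : Type*} [Fintype V] {H : SimpleGraph V}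
    (h : ¬ H.Connected) (C : H.ConnectedComponent) : (compSize H C : ℕ) < Fintype.card V := by
  classical
  obtain ⟨a, rfl⟩ := connectedComponentMk_surjective H C
  rw [compSize_mk, Nat.card_eq_fintype_card]
  by_contra! hle
  have huniv := (Fintype.card_subtype_le _).antisymm hle
  have : ∀ b, H.Reachable b a := by
    rw [Fintype.card_subtype, Finset.card_eq_iff_eq_univ] at huniv
    intro b
    have hb := Finset.mem_univ b
    rw [← huniv, Finset.mem_filter] at hb
    exact hb.2
  exact h ((SimpleGraph.connected_iff _).2 ⟨fun b c => (this b).trans (this c).symm, ⟨a⟩⟩)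

theorem compSize_of_connected {V : Type*} [Fintype V] {H : SimpleGraph V} (h : H.Connected)
    (C : H.ConnectedComponent) : (compSize H C : ℕ) = Fintype.card V := by
  classical
  obtain ⟨a, rfl⟩ := connectedComponentMk_surjective H C
  rw [compSize_mk, ← Nat.card_eq_fintype_card]
  exact Nat.card_congr (Equiv.subtypeUnivEquiv fun b => h.preconnected b a)

/-- The chromatic symmetric function of a tree on `n` vertices is `±p_n` up to products of power
sums of smaller degree, so that it determines the value at `p_n` of an algebra morphism. -/
theorem algHom_psum_eq_of_tree {A : Type*} [CommRing A] [Algebra K A] {f g : Lambda K →ₐ[K] A}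
    {V : Type*} [Fintype V] {T : SimpleGraph V} (hT : T.IsTree) {n : ℕ+}
    (hn : Fintype.card V = n) (hlt : ∀ m < n, f (psum K m) = g (psum K m))
    (h : f (csf K T fun _ => 1) = g (csf K T fun _ => 1)) : f (psum K n) = g (psum K n) := by
  classical
  rw [csf_eq_sum, map_sum, map_sum, ← Finset.sum_erase_add _ _ (Finset.mem_powerset_self _),
    ← Finset.sum_erase_add _ _ (Finset.mem_powerset_self _)] at h
  have hprod : ∀ S : Finset (Sym2 V), ∀ (e : Lambda K →ₐ[K] A),
      e (csf K ⊥ (compSize (SimpleGraph.fromEdgeSet (S : Set (Sym2 V))))) =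
        ∏ C, e (psum K (compSize (SimpleGraph.fromEdgeSet (S : Set (Sym2 V))) C)) :=
    fun S e => by rw [← prod_psum, map_prod]
  -- The proper subsets contribute equally under `f` and `g`, which is the second goal, so only the
  -- term of the full edge set is left.
  rw [Finset.sum_congr rfl fun S hS => ?_, add_right_inj, map_smul, map_smul] at h
  · have h' := smul_right_injective A (pow_ne_zero _ (neg_ne_zero.2 (one_ne_zero (α := K)))) h
    rw [hprod, hprod] at h'
    have hconn : (SimpleGraph.fromEdgeSet (T.edgeFinset : Set (Sym2 V))).Connected := by
      rw [SimpleGraph.coe_edgeFinset, SimpleGraph.fromEdgeSet_edgeSet]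
      exact hT.connected
    have hsize : ∀ C, compSize (SimpleGraph.fromEdgeSet (T.edgeFinset : Set (Sym2 V))) C = n :=
      fun C => PNat.coe_injective ((compSize_of_connected hconn C).trans hn)
    have := hconn.nonempty
    have : Subsingleton
        (SimpleGraph.fromEdgeSet (T.edgeFinset : Set (Sym2 V))).ConnectedComponent :=
      hconn.preconnected.subsingleton_connectedComponent
    -- With all edges present there is one component, of size `n`, so the product is the single
    -- factor `p_n`.
    simp_rw [hsize, Finset.prod_const, Finset.card_univ] at h'
    rwa [Fintype.card_eq_one_iff_nonempty_unique.2
      ⟨uniqueOfSubsingleton (SimpleGraph.connectedComponentMk _ (Classical.arbitrary V))⟩,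
      pow_one, pow_one] at h'
  · obtain ⟨hne, hS⟩ := Finset.mem_erase.1 hS
    rw [Finset.mem_powerset] at hS
    rw [map_smul, map_smul, hprod, hprod]
    congr 1
    refine Finset.prod_congr rfl fun C _ => hlt _ ?_
    rw [← PNat.coe_lt_coe, ← hn]
    refine compSize_lt_of_not_connected (fun hc => ?_) C
    -- A connected graph has at least `|V| - 1` edges, which is the number of edges of `T`; a proper
    -- subset has fewer.
    have h1 := hc.card_vert_le_card_edgeSet_add_one
    rw [Nat.card_eq_fintype_card, Nat.card_eq_fintype_card, ← SimpleGraph.edgeFinset_card,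
      edgeFinset_fromEdgeSet T hS, ← hT.card_edgeFinset] at h1
    exact absurd (Finset.card_lt_card (hS.ssubset_of_ne hne)) (by omega)

theorem algHom_eq_of_csf {A : Type*} [CommRing A] [Algebra K A] {f g : Lambda K →ₐ[K] A}
    (h : ∀ (V : Type v) [Fintype V] (G : SimpleGraph V), G.CliqueFree 3 →
      f (csf K G fun _ => 1) = g (csf K G fun _ => 1)) : f = g := by
  refine Lambda_algHom_ext fun n => ?_
  induction n using PNat.strongInductionOn with
  | _ n ih =>
    -- Any tree on `n` vertices serves, here a spanning tree of the complete graph; `ULift` places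
    -- its vertices in the universe where the hypothesis applies.
    have : Nonempty (ULift.{v} (Fin n)) := ⟨⟨⟨0, n.pos⟩⟩⟩
    obtain ⟨T, -, hT⟩ :=
      (SimpleGraph.connected_top (V := ULift.{v} (Fin n))).exists_isTree_le
    exact algHom_psum_eq_of_tree hT (by simp) ih (h _ T (hT.isAcyclic.cliqueFree le_rfl))

end SymmFun
end

/-! ### Existence and uniqueness of the morphism. -/

theorem proposition1p7 (K : Type u) [Field K] [CharZero K] :
    ∃ φ : Lambda K →ₐc[K] LambdaTilde K,
      IsGraded φ ∧
      (∀ (V : Type v) [Fintype V] (G : SimpleGraph V), G.CliqueFree 3 →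
        φ (csf K G fun _ => 1) = toTilde K (csf K Gᶜ fun _ => 1)) ∧
      φ (psum K 1) = mtildeT K 1 ∧
      φ (psum K 2) = -mtildeT K 2 ∧
      (∀ n : ℕ+, 3 ≤ n → φ (psum K n) = 0) ∧
      (∀ ψ : Lambda K →ₐc[K] LambdaTilde K, IsGraded ψ →
        (∀ (V : Type v) [Fintype V] (G : SimpleGraph V), G.CliqueFree 3 →
          ψ (csf K G fun _ => 1) = toTilde K (csf K Gᶜ fun _ => 1)) → ψ = φ) := by
  refine ⟨scaleHom (pairingCoeff K), isGraded_scaleHom _, fun V _ G hG => scaleHom_csf hG,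
    ?_, ?_, fun n hn => ?_, fun ψ _ hψ => ?_⟩
  · simp [scaleHom_psum, pairingCoeff]
  · simp [scaleHom_psum, pairingCoeff]
  · have h1 : n ≠ 1 := by rintro rfl; exact absurd hn (by decide)
    have h2 : n ≠ 2 := by rintro rfl; exact absurd hn (by decide)
    simp [scaleHom_psum, pairingCoeff, h1, h2]
  · have : (ψ : Lambda K →ₐ[K] LambdaTilde K) = (scaleHom (pairingCoeff K)) :=
      algHom_eq_of_csf.{v} fun V _ G hG => (hψ V G hG).trans (scaleHom_csf hG).symm
    exact DFunLike.ext _ _ fun x => DFunLike.congr_fun this x
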